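/- Let $(M,\mathcal B,m)$ be a measure space, $f:M\to M$ a measurable map, and $\Delta_0\in\mathcal B$ with $0<m(\Delta_0)<\infty$; write $m$ also for the restriction of $m$ to $\Delta_0$. Let $F:\Delta_0\to\Delta_0$ be an induced map for $f$: there are a countable $m$ mod $0$ partition $\mathcal P_0$ of $\Delta_0$ (pairwise disjoint measurable sets covering $\Delta_0$ up to a null set) and a measurable $R:\Delta_0\to\{1,2,3,\dots\}$, constant on each $\omega\in\mathcal P_0$, such that $F|_\omega=f^{R(\omega)}|_\omega$ for all $\omega\in\mathcal P_0$. Assume that $F$ is a weak Gibbs Markov (WGM) map with respect to $\mathcal P_0$. That is, $F$ is measurable, is a bijection from each $\omega\in\mathcal P_0$ onto a measurable set $F(\omega)$ with measurable inverse, and: * (Markov) for each $\omega\in\mathcal P_0$, $F(\omega)$ is, mod $0$, a union of elements of $\mathcal P_0$; * (separability) the sets $\omega_0\cap F^{-1}(\omega_1)\cap\dots\cap F^{-(n-1)}(\omega_{n-1})$, $n\ge1$, $\omega_i\in\mathcal P_0$, generate the $\sigma$-algebra of $\Delta_0$ mod $0$, and each set $\bigcap_{i\ge0}F^{-i}(\omega_i)$,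 $\omega_i\in\mathcal P_0$, has at most one point; * (nonsingular) there is a measurable $J_F:\Delta_0\to(0,\infty)$ with $m(F(A))=\int_A J_F\,dm$ for every measurable $A\subset\omega\in\mathcal P_0$; * (Gibbs) there are $C_F>0$ and $0<\beta<1$ such that $\log\frac{J_F(x)}{J_F(y)}\le C_F\beta^{s(F(x),F(y))}$ for all $\omega\in\mathcal P_0$ and $x,y\in\omega$, where $s(x,y)\in\{0,1,\dots\}\cup\{\infty\}$ is the least $n\ge0$ such that $F^n(x)$ and $F^n(y)$ do not lie in a common element of $\mathcal P_0$, and $\beta^\infty=0$; * (long branches) there is $\delta_0>0$ with $m(F(\omega))\ge\delta_0$ for all $\omega\in\mathcal P_0$. Assume moreover: * (aperiodicity) for all $\omega_1,\omega_2\in\mathcal P_0$ there is $k_0$ such that $m(\omega_1\cap F^{-n}(\omega_2))>0$ for all $n\ge k_0$; * (coprime block) there are $N\ge2$ and (not necessarily distinct) $\omega_1,\dots,\omega_N\in\mathcal P_0$ with $\gcd\{R(\omega_i)\}_{i}=1$ and $F(\omega_i)\supseteq\omega_1\cup\dots\cup\omega_N$ ($m$ mod $0$) for all $i$; * $R\in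 L^1(m)$. Let $\Delta=\{(x,\ell):x\in\Delta_0,\ 0\le\ell<R(x)\}$ be the tower, with the $\sigma$-algebra and the measure $m$ obtained by identifying each level $\{(x,\ell)\in\Delta\}$ with $\{R>\ell\}\subset\Delta_0$, and let $T:\Delta\to\Delta$ be the tower map: $T(x,\ell)=(x,\ell+1)$ if $R(x)>\ell+1$, and $T(x,\ell)=(F(x),0)$ if $R(x)=\ell+1$. Then there is a unique $T$-invariant probability measure $\nu\ll m$ on $\Delta$. It is exact, that is, every set in $\bigcap_{n\ge0}T^{-n}(\mathcal A)$, where $\mathcal A$ is the $\sigma$-algebra of $\Delta$, has $\nu$-measure $0$ or $1$; hence it is mixing, that is, $\nu(A\cap T^{-n}(B))\to\nu(A)\nu(B)$ as $n\to\infty$ for all $A,B\in\mathcal A$. -/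

import Mathlib

open MeasureTheory Set Filter Topology
open scoped ENNReal

namespace WeakGibbsMarkov

noncomputable section

section MarkovMaps

variable {X : Type*}

/-- A finite or countable partition of `X` (mod `m`) into measurable sets: the elements are
pairwise disjoint and cover `X` up to a null set. -/
structure IsModPartition [MeasurableSpace X] (m : Measure X) (P : Set (Set X)) : Prop where
  countable : P.Countable
  measurableSet : ∀ ω ∈ P, MeasurableSet ω
  disjoint : P.PairwiseDisjoint id
  cover : m (⋃₀ P)ᶜ = 0

/-- The partition `P ∨ F⁻¹ P ∨ ⋯ ∨ F⁻⁽ⁿ⁻¹⁾ P`: its elements are the sets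
`ω₀ ∩ F⁻¹ ω₁ ∩ ⋯ ∩ F⁻⁽ⁿ⁻¹⁾ ωₙ₋₁`. -/
def cylinders (F : X → X) (P : Set (Set X)) (n : ℕ) : Set (Set X) :=
  {A | ∃ ω : Fin n → Set X, (∀ i, ω i ∈ P) ∧ A = ⋂ i : Fin n, F^[(i : ℕ)] ⁻¹' ω i}

/-- The infinite join of the partitions `F⁻ⁱ P`: its elements are the sets
`ω₀ ∩ F⁻¹ ω₁ ∩ F⁻² ω₂ ∩ ⋯`. -/
def limitCylinders (F : X → X) (P : Set (Set X)) : Set (Set X) :=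
  {A | ∃ ω : ℕ → Set X, (∀ i, ω i ∈ P) ∧ A = ⋂ i : ℕ, F^[i] ⁻¹' ω i}

/-- The cylinders form a basis: they generate the σ-algebra mod `m`, and the nonempty elements of
the infinite join are single points. -/
def IsBasis [MeasurableSpace X] (m : Measure X) (F : X → X) (P : Set (Set X)) : Prop :=
  (∀ A : Set X, MeasurableSet A → ∃ B : Set X,
    MeasurableSet[MeasurableSpace.generateFrom {C | ∃ n : ℕ, 1 ≤ n ∧ C ∈ cylinders F P n}] B ∧
      A =ᵐ[m] B) ∧
  ∀ A ∈ limitCylinders F P, A.Subsingleton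

/-- The separation time of `x` and `y`: the least `n` such that `Fⁿ x` and `Fⁿ y` do not lie in a
common element of `P`, and `⊤` if there is no such `n`. Two points whose orbits stay in `⋃₀ P`
(almost every point, for the maps considered here) fail to lie in a common element exactly when
they lie in distinct elements. -/
def sepTime (F : X → X) (P : Set (Set X)) (x y : X) : ℕ∞ :=
  ⨅ n ∈ {n : ℕ | ¬ ∃ ω ∈ P, F^[n] x ∈ ω ∧ F^[n] y ∈ ω}, (n : ℕ∞)

/-- `β ^ s` for `0 < β < 1` and `s ∈ ℕ ∪ {∞}`, with `β ^ ∞ = 0`. -/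
def powENat (β : ℝ) (s : ℕ∞) : ℝ :=
  if s = ⊤ then 0 else β ^ s.toNat

/-- `F : X → X` is a weak Gibbs Markov map of the measure space `(X, m)` with respect to the
partition (mod `m`) `P` of `X` into invertibility domains of `F`. -/
structure IsWGM [MeasurableSpace X] (m : Measure X) (F : X → X) (P : Set (Set X)) : Prop where
  measurable : Measurable F
  partition : IsModPartition m P
  /-- `F` is a bijection from `ω` to `F ω` with measurable inverse. -/
  invertible : ∀ ω ∈ P, MeasurableEmbedding (ω.domRestrict F)
  /-- `F ω` is (mod `m`) a union of elements of `P`. -/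
  markov : ∀ ω ∈ P, ∃ Q ⊆ P, F '' ω =ᵐ[m] ⋃₀ Q
  separability : IsBasis m F P
  /-- Nonsingularity, with a strictly positive Jacobian `J`, and the Gibbs property of `J`. -/
  gibbs : ∃ J : X → ℝ, Measurable J ∧ (∀ x, 0 < J x) ∧
    (∀ ω ∈ P, ∀ A ⊆ ω, MeasurableSet A → m (F '' A) = ∫⁻ x in A, ENNReal.ofReal (J x) ∂m) ∧
    ∃ C β : ℝ, 0 < C ∧ 0 < β ∧ β < 1 ∧ ∀ ω ∈ P, ∀ x ∈ ω, ∀ y ∈ ω,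
      Real.log (J x / J y) ≤ C * powENat β (sepTime F P (F x) (F y))
  longBranches : ∃ δ : ℝ≥0∞, 0 < δ ∧ ∀ ω ∈ P, δ ≤ m (F '' ω)

/-- Aperiodicity of `F` with respect to the partition `P`. -/
def IsAperiodic [MeasurableSpace X] (m : Measure X) (F : X → X) (P : Set (Set X)) : Prop :=
  ∀ ω₁ ∈ P, ∀ ω₂ ∈ P, ∃ k₀ : ℕ, ∀ n ≥ k₀, 0 < m (ω₁ ∩ F^[n] ⁻¹' ω₂)

/-- `F`, with return time `R`, has a coprime block: there are `N ≥ 2` elements `ω i` of `P`, with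
constant return times `r i` of greatest common divisor `1`, such that the image of each `ω i`
contains (mod `m`) the union of all of them. -/
def HasCoprimeBlock [MeasurableSpace X] (m : Measure X) (F : X → X) (P : Set (Set X))
    (R : X → ℕ) : Prop :=
  ∃ (N : ℕ) (ω : Fin N → Set X) (r : Fin N → ℕ), 2 ≤ N ∧ (∀ i, ω i ∈ P) ∧
    (∀ i, ∀ x ∈ ω i, R x = r i) ∧ Finset.univ.gcd r = 1 ∧
    ∀ i, (⋃ j, ω j) ≤ᵐ[m] F '' ω i

end MarkovMaps

/-- `F : Δ₀ → Δ₀` is an induced map for `f : M → M`, with return time `R` and partition `P`: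
`R` is measurable and constant on the elements of `P`, and `F = f ^ R` on each of them. -/
structure IsInducedMap {M : Type*} [MeasurableSpace M] (m : Measure M) (f : M → M) (Δ₀ : Set M)
    (F : Δ₀ → Δ₀) (P : Set (Set Δ₀)) (R : Δ₀ → ℕ) : Prop where
  partition : IsModPartition (m.comap ((↑) : Δ₀ → M)) P
  measurable : Measurable R
  const : ∀ ω ∈ P, ∀ x ∈ ω, ∀ y ∈ ω, R x = R y
  eq_iterate : ∀ ω ∈ P, ∀ x ∈ ω, (F x : M) = f^[R x] (x : M)

section Tower

variable {X : Type*}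

/-- The tower `{(x, ℓ) : 0 ≤ ℓ < R x}`, with the σ-algebra of the product `X × ℕ`. -/
abbrev Tower (R : X → ℕ) : Type _ := {p : X × ℕ // p.2 < R p.1}

/-- The tower map: `(x, ℓ) ↦ (x, ℓ + 1)` if `ℓ + 1 < R x`, and `(x, ℓ) ↦ (F x, 0)` if
`ℓ + 1 = R x`. -/
def towerMap (F : X → X) (R : X → ℕ) (hR : ∀ x, 0 < R x) (p : Tower R) : Tower R :=
  if h : p.1.2 + 1 < R p.1.1 then ⟨(p.1.1, p.1.2 + 1), h⟩ else ⟨(F p.1.1, 0), hR _⟩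

/-- The reference measure on the tower: on the level `{(x, ℓ) : R x > ℓ}` it is the copy of `m`
restricted to `{R > ℓ}`. -/
def towerMeasure [MeasurableSpace X] (m : Measure X) (R : X → ℕ) : Measure (Tower R) :=
  (m.prod (Measure.count : Measure ℕ)).comap Subtype.val

end Tower

section Invariant

variable {Y : Type*} [MeasurableSpace Y]

/-- `ν` is a `T`-invariant probability measure, absolutely continuous with respect to `m`. -/
structure IsACIP (T : Y → Y) (m ν : Measure Y) : Prop where
  prob : IsProbabilityMeasure ν
  invariant : MeasurePreserving T ν ν
  absCont : ν ≪ m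

/-- Exactness: every set of the tail σ-algebra `⋂ₙ T⁻ⁿ 𝒜` has measure `0` or `1`. -/
def IsExact (T : Y → Y) (ν : Measure Y) : Prop :=
  ∀ A : Set Y, MeasurableSet[⨅ n : ℕ, MeasurableSpace.comap T^[n] inferInstance] A →
    ν A = 0 ∨ ν A = 1

/-- Mixing. -/
def IsMixing (T : Y → Y) (ν : Measure Y) : Prop :=
  ∀ A B : Set Y, MeasurableSet A → MeasurableSet B →
    Tendsto (fun n : ℕ => ν (A ∩ T^[n] ⁻¹' B)) atTop (𝓝 (ν A * ν B))

end Invariant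

end

end WeakGibbsMarkov

/-! Everything rests on one fact: tail sets of the tower are null or conull for the reference
measure (`IsWGM.tail_trivial`). Exactness follows by absolute continuity, uniqueness because the
midpoint of two candidates is ergodic, and mixing by an L² argument.

Bounded distortion and long branches give two things. First, m(F⁻ⁿA) ≤ K m(A), so limits of Cesàro
averages yield an invariant measure dominated by m (`exists_invariant_le`); its lift to the tower is
finite because R is integrable, whence existence. Second, a set of positive measure nearly fills
some cylinder, whose image contains one of finitely many partition elements, and aperiodicity
carries it on over almost all of any prescribed element b (`IsWGM.exists_word_measure_diff_le`).

The coprime block supplies such a b with two return words of durations a and a+1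
(`IsWGM.exists_consecutive_returns`). Suppose that the base points of a tail set A which leave A at
the next step have positive measure. Spread over b in time τ, then along both return words, two of
them x, x' satisfy T^(a+τ) x = T^(a+τ) (T x'), with x in A and T x' outside: impossible, as A is a
preimage under T^(a+τ). So almost every orbit from the base stays in A or in its complement, and a
second spreading shows that only one of the two can charge the base. -/

namespace WeakGibbsMarkov

/-! ### Tail sets, exactness, mixing and uniqueness -/

section Exactness

variable {Y : Type*} [MeasurableSpace Y] {T : Y → Y} {m ν : Measure Y}

/-- A set is a tail set if it is, for every `n`, the preimage under `Tⁿ` of a measurable set. -/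
def IsTail (T : Y → Y) (A : Set Y) : Prop :=
  ∀ n : ℕ, ∃ B : Set Y, MeasurableSet B ∧ T^[n] ⁻¹' B = A

theorem measurableSet_tail_iff {A : Set Y} :
    MeasurableSet[⨅ n : ℕ, MeasurableSpace.comap T^[n] inferInstance] A ↔ IsTail T A := by
  rw [MeasurableSpace.measurableSet_iInf]
  rfl

theorem IsTail.measurableSet {A : Set Y} (hA : IsTail T A) : MeasurableSet A := by
  obtain ⟨B, hB, rfl⟩ := hA 0
  exact hB

theorem IsTail.compl {A : Set Y} (hA : IsTail T A) : IsTail T Aᶜ := by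
  intro n
  obtain ⟨B, hB, rfl⟩ := hA n
  exact ⟨Bᶜ, hB.compl, rfl⟩

theorem IsTail.preimage (hT : Measurable T) {A : Set Y} (hA : IsTail T A) (k : ℕ) :
    IsTail T (T^[k] ⁻¹' A) := by
  intro n
  obtain ⟨B, hB, rfl⟩ := hA n
  refine ⟨T^[k] ⁻¹' B, (hT.iterate k) hB, ?_⟩
  rw [← preimage_comp, ← preimage_comp, ← Function.iterate_add, ← Function.iterate_add, add_comm]

theorem isTail_of_preimage_eq {A : Set Y} (hA : MeasurableSet A) (h : T ⁻¹' A = A) :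
    IsTail T A := by
  refine fun n => ⟨A, hA, ?_⟩
  rw [Set.preimage_iterate_eq]
  exact Function.iterate_fixed h n

/-- The upper limit of the sets `T⁻ⁿ (s n)` is a tail set. -/
theorem isTail_limsup (hT : Measurable T) {s : ℕ → Set Y} (hs : ∀ n, MeasurableSet (s n)) :
    IsTail T (⋂ k : ℕ, ⋃ j : ℕ, T^[k + j] ⁻¹' s (k + j)) := by
  intro n
  -- An upper limit ignores the first n terms, and the later ones all factor through Tⁿ.
  refine ⟨⋂ k : ℕ, ⋃ j : ℕ, T^[k + j] ⁻¹' s (n + (k + j)),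
    .iInter fun k => .iUnion fun j => (hT.iterate _) (hs _), ?_⟩
  ext x
  simp only [mem_preimage, mem_iInter, mem_iUnion, ← Function.iterate_add_apply]
  constructor
  · intro h k
    obtain ⟨j, hj⟩ := h k
    refine ⟨n + j, ?_⟩
    rwa [show k + (n + j) = n + (k + j) by ring, show n + (k + j) = k + j + n by ring] at *
  · intro h k
    obtain ⟨j, hj⟩ := h (n + k)
    refine ⟨j, ?_⟩
    rwa [show k + j + n = n + k + j by ring, show n + (k + j) = n + k + j by ring]

/-- If `g` agrees almost everywhere with a function of `Tⁿ` for every `n`, and tail sets are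
trivial, then `g` is almost everywhere constant. -/
theorem IsExact.ae_const [IsProbabilityMeasure ν] (hT : Measurable T) (h : IsExact T ν)
    {g : Y → ℝ} (G : ℕ → Y → ℝ) (hG : ∀ n, Measurable (G n))
    (hg : ∀ n, g =ᵐ[ν] G n ∘ T^[n]) : ∃ c : ℝ, g =ᵐ[ν] Function.const Y c := by
  refine exists_eventuallyEq_const_of_forall_separating MeasurableSet fun U hU => ?_
  have htail := isTail_limsup hT (s := fun n => G n ⁻¹' U) fun n => hG n hU
  -- The preimage of U under g need not be a tail set, but every term of the upper limit agrees with
  -- it almost everywhere, hence so does the upper limit.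
  have hall : ∀ᵐ x ∂ν, ∀ n, g x = G n (T^[n] x) := ae_all_iff.2 hg
  have key : ∀ᵐ x ∂ν, x ∈ (⋂ k : ℕ, ⋃ j : ℕ, T^[k + j] ⁻¹' (G (k + j) ⁻¹' U)) ↔ g x ∈ U := by
    filter_upwards [hall] with x hx
    simp only [mem_iInter, mem_iUnion, mem_preimage, ← hx]
    simp
  rcases h _ (measurableSet_tail_iff.2 htail) with h0 | h1
  · right
    filter_upwards [key, measure_eq_zero_iff_ae_notMem.1 h0] with x hx hx'
    rwa [← hx]
  · left
    filter_upwards [key, (prob_compl_eq_zero_iff htail.measurableSet).2 h1] with x hx hx'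
    rw [← hx]
    simpa using hx'

/-- The space of square integrable functions of `Tⁿ`. -/
noncomputable def compRange (hT : MeasurePreserving T ν ν) (n : ℕ) : Submodule ℝ (Lp ℝ 2 ν) :=
  (Lp.compMeasurePreservingₗᵢ ℝ T^[n] (hT.iterate n)).toLinearMap.range

theorem isClosed_compRange (hT : MeasurePreserving T ν ν) (n : ℕ) :
    IsClosed (compRange hT n : Set (Lp ℝ 2 ν)) := by
  have := (Lp.compMeasurePreservingₗᵢ ℝ (E := ℝ) (p := 2) T^[n] (hT.iterate n)).isometry
  have h := this.isClosedEmbedding.isClosed_range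
  exact h

theorem compRange_antitone (hT : MeasurePreserving T ν ν) : Antitone (compRange hT) := by
  refine antitone_nat_of_succ_le fun n => ?_
  rintro _ ⟨g, rfl⟩
  refine ⟨Lp.compMeasurePreserving T hT g, ?_⟩
  refine (Lp.compMeasurePreserving_comp_apply g hT (hT.iterate n)).symm.trans ?_
  have hfun : T ∘ T^[n] = T^[n + 1] := (Function.iterate_succ' T n).symm
  refine Lp.ext ?_
  refine (Lp.coeFn_compMeasurePreserving g (hT.comp (hT.iterate n))).trans ?_
  rw [hfun]
  exact (Lp.coeFn_compMeasurePreserving g (hT.iterate (n + 1))).symm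

/-- Membership in every range means being a function of Tⁿ for every n, which exactness forces to be
constant. -/
theorem IsExact.eq_const_of_mem_iInf_compRange [IsProbabilityMeasure ν]
    (hT : MeasurePreserving T ν ν) (h : IsExact T ν) {g : Lp ℝ 2 ν}
    (hg : g ∈ ⨅ n, compRange hT n) : ∃ c : ℝ, g = indicatorConstLp 2 .univ (measure_ne_top ν _) c := by
  rw [Submodule.mem_iInf] at hg
  choose G hG using hg
  obtain ⟨c, hc⟩ := h.ae_const hT.measurable (g := g) (fun n => G n)
    (fun n => (Lp.stronglyMeasurable _).measurable)
    (fun n => by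
      have := Lp.coeFn_compMeasurePreserving (G n) (hT.iterate n)
      have h2 := hG n
      refine Filter.EventuallyEq.trans (Filter.EventuallyEq.of_eq ?_) this
      rw [← h2]
      rfl)
  refine ⟨c, Lp.ext (hc.trans ?_)⟩
  filter_upwards [indicatorConstLp_coeFn (p := 2) (μ := ν) (hs := MeasurableSet.univ)
    (hμs := measure_ne_top ν _) (c := c)] with x hx
  rw [hx]
  simp

/-- Exactness implies mixing. -/
theorem IsExact.isMixing [IsProbabilityMeasure ν] (hT : MeasurePreserving T ν ν)
    (h : IsExact T ν) : IsMixing T ν := by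
  intro A B hA hB
  set a : Lp ℝ 2 ν := indicatorConstLp 2 hA (measure_ne_top ν _) (1 : ℝ) with ha
  set b : Lp ℝ 2 ν := indicatorConstLp 2 hB (measure_ne_top ν _) (1 : ℝ) with hb
  set e : Lp ℝ 2 ν := indicatorConstLp 2 .univ (measure_ne_top ν _) (1 : ℝ) with he
  set f : Lp ℝ 2 ν := a - ν.real A • e with hf
  have hfe : inner ℝ f e = 0 := by
    rw [hf, inner_sub_left, real_inner_smul_left, ha, he,
      L2.inner_indicatorConstLp_one_indicatorConstLp_one,
      L2.inner_indicatorConstLp_one_indicatorConstLp_one]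
    simp
  -- The ranges are closed, so this closure is the orthogonal complement of their intersection,
  -- which consists of constants.
  have hfK : f ∈ (⨆ n, (compRange hT n)ᗮ).topologicalClosure := by
    rw [← Submodule.orthogonal_orthogonal_eq_closure, ← Submodule.iInf_orthogonal]
    rw [Submodule.mem_orthogonal]
    intro g hg
    have hg' : g ∈ ⨅ n, compRange hT n := by
      rw [Submodule.mem_iInf] at hg ⊢
      intro n
      have := hg n
      rwa [Submodule.orthogonal_orthogonal_eq_closure,
        (isClosed_compRange hT n).submodule_topologicalClosure_eq] at this
    obtain ⟨c, rfl⟩ := h.eq_const_of_mem_iInf_compRange hT hg'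
    have : indicatorConstLp 2 .univ (measure_ne_top ν _) c = c • e := by
      rw [he]
      refine Lp.ext ?_
      filter_upwards [indicatorConstLp_coeFn (p := 2) (μ := ν) (hs := MeasurableSet.univ)
        (hμs := measure_ne_top ν _) (c := c), Lp.coeFn_smul c e,
        indicatorConstLp_coeFn (p := 2) (μ := ν) (hs := MeasurableSet.univ)
        (hμs := measure_ne_top ν _) (c := (1 : ℝ))] with x h1 h2 h3
      rw [h1, h2, Pi.smul_apply, h3]
      simp
    rw [this, real_inner_smul_left, real_inner_comm, hfe, mul_zero]
  set U : ℕ → Lp ℝ 2 ν → Lp ℝ 2 ν := fun n => Lp.compMeasurePreserving T^[n] (hT.iterate n)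
  have hUnorm : ∀ n g, ‖U n g‖ = ‖g‖ := fun n g => Lp.norm_compMeasurePreserving g (hT.iterate n)
  have hUind : ∀ n {S : Set Y} (hS : MeasurableSet S),
      U n (indicatorConstLp 2 hS (measure_ne_top ν _) (1 : ℝ)) =
        indicatorConstLp 2 ((hT.iterate n).measurable hS) (measure_ne_top ν _) (1 : ℝ) :=
    fun n S hS => rfl
  have hlim : Tendsto (fun n => (inner ℝ f (U n b) : ℝ)) atTop (𝓝 0) := by
    rw [Metric.tendsto_atTop]
    intro ε hε
    have hpos : 0 < ‖b‖ + 1 := by positivity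
    have hcl : f ∈ closure ((⨆ n, (compRange hT n)ᗮ : Submodule ℝ (Lp ℝ 2 ν)) : Set (Lp ℝ 2 ν)) :=
      hfK
    obtain ⟨g, hg, hfg⟩ := Metric.mem_closure_iff.1 hcl (ε / (‖b‖ + 1)) (by positivity)
    -- The complements increase, so the approximant g lies in a single one of them and is orthogonal
    -- to all later iterates of b.
    have hmono : Monotone fun n => (compRange hT n)ᗮ :=
      fun i j hij => Submodule.orthogonal_le (compRange_antitone hT hij)
    obtain ⟨n, hn⟩ := (Submodule.mem_iSup_of_directed _ hmono.directed_le).1 hg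
    refine ⟨n, fun k hk => ?_⟩
    have h0 : inner ℝ g (U k b) = 0 := by
      have := (Submodule.mem_orthogonal _ _).1 (hmono hk hn) (U k b) ⟨b, rfl⟩
      rwa [real_inner_comm]
    have : inner ℝ f (U k b) = inner ℝ (f - g) (U k b) := by
      rw [inner_sub_left f g, h0, sub_zero]
    rw [dist_zero_right, this]
    calc ‖inner ℝ (f - g) (U k b)‖ ≤ ‖f - g‖ * ‖U k b‖ := norm_inner_le_norm _ _
      _ ≤ ‖f - g‖ * (‖b‖ + 1) := by rw [hUnorm]; gcongr; linarith
      _ < ε := by rwa [dist_eq_norm, lt_div_iff₀ hpos] at hfg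
  have hreal : ∀ n, ν.real (A ∩ T^[n] ⁻¹' B) = inner ℝ f (U n b) + ν.real A * ν.real B := by
    intro n
    rw [hf, inner_sub_left, real_inner_smul_left, hb, hUind, ha, he,
      L2.inner_indicatorConstLp_one_indicatorConstLp_one,
      L2.inner_indicatorConstLp_one_indicatorConstLp_one]
    simp [measureReal_def, (hT.iterate n).measure_preimage hB.nullMeasurableSet]
  have hr : Tendsto (fun n => ν.real (A ∩ T^[n] ⁻¹' B)) atTop (𝓝 (ν.real A * ν.real B)) := by
    simp_rw [hreal]
    simpa using hlim.add_const (ν.real A * ν.real B)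
  rw [← ENNReal.tendsto_toReal_iff (fun n => measure_ne_top ν _)
    (ENNReal.mul_ne_top (measure_ne_top ν _) (measure_ne_top ν _)), ENNReal.toReal_mul]
  exact hr

/-- If every tail set is null or conull for `m`, then every absolutely continuous invariant
probability measure is exact. -/
theorem IsACIP.isExact (h : ∀ A, IsTail T A → m A = 0 ∨ m Aᶜ = 0) (hν : IsACIP T m ν) :
    IsExact T ν := by
  have := hν.prob
  intro A hA
  rw [measurableSet_tail_iff] at hA
  rcases h A hA with h0 | h0
  · exact .inl (hν.absCont h0)
  · exact .inr ((prob_compl_eq_zero_iff hA.measurableSet).1 (hν.absCont h0))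

/-- If every tail set is null or conull for `m`, then there is at most one absolutely continuous
invariant probability measure. -/
theorem IsACIP.unique (h : ∀ A, IsTail T A → m A = 0 ∨ m Aᶜ = 0) {ν' : Measure Y}
    (hν : IsACIP T m ν) (hν' : IsACIP T m ν') : ν = ν' := by
  have := hν.prob
  have := hν'.prob
  -- Strictly invariant sets are tail sets, so the midpoint is ergodic; both measures are absolutely
  -- continuous with respect to it and hence equal to it.
  set η : Measure Y := (2⁻¹ : ℝ≥0∞) • (ν + ν') with hη
  have hprob : IsProbabilityMeasure η := ⟨by
    simp [hη, ENNReal.inv_two_add_inv_two]⟩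
  have hinv : MeasurePreserving T η η := by
    refine MeasurePreserving.smul_measure ⟨hν.invariant.measurable, ?_⟩ _
    rw [Measure.map_add _ _ hν.invariant.measurable, hν.invariant.map_eq, hν'.invariant.map_eq]
  have hac : η ≪ m := (hν.absCont.add_left hν'.absCont).smul_left _
  have herg : Ergodic T η := by
    refine ⟨hinv, ⟨fun s hs hTs => ?_⟩⟩
    rw [eventuallyConst_set']
    rcases h s (isTail_of_preimage_eq hs hTs) with h0 | h0
    · exact .inl (ae_eq_empty.2 (hac h0))
    · exact .inr (ae_eq_univ.2 (hac h0))
  have h2 : (2⁻¹ : ℝ≥0∞) ≠ 0 := by simp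
  have h1 : ν ≪ η := (Measure.AbsolutelyContinuous.rfl.add_right ν').trans
    (Measure.absolutelyContinuous_smul h2)
  have h1' : ν' ≪ η := ((Measure.AbsolutelyContinuous.rfl.add_right ν).trans
    (by rw [add_comm])).trans (Measure.absolutelyContinuous_smul h2)
  rw [herg.eq_of_absolutelyContinuous hν.invariant h1,
    herg.eq_of_absolutelyContinuous hν'.invariant h1']

end Exactness

/-! ### Invariant measures from dominated Cesàro averages -/

section InvariantMeasure

variable {X : Type*} [MeasurableSpace X] {m : Measure X} {F : X → X}

/-- A finitely additive set function dominated by a finite measure is a measure. -/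
theorem exists_measure_of_additive_le [IsFiniteMeasure m] {K : ℝ≥0∞} (hK : K ≠ ∞)
    (L : Set X → ℝ≥0∞) (hle : ∀ A, MeasurableSet A → L A ≤ K * m A)
    (hadd : ∀ A B, MeasurableSet A → MeasurableSet B → Disjoint A B → L (A ∪ B) = L A + L B) :
    ∃ μ : Measure X, ∀ A, MeasurableSet A → μ A = L A := by
  have h0 : L ∅ = 0 := by simpa using hle ∅ .empty
  have hunion : ∀ f : ℕ → Set X, (∀ i, MeasurableSet (f i)) → Pairwise (Function.onFun Disjoint f) →
      L (⋃ i, f i) = ∑' i, L (f i) := by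
    intro f hf hd
    have hsplit : ∀ N, L (⋃ i, f i) = ∑ i ∈ Finset.range N, L (f i) + L (⋃ i ≥ N, f i) := by
      intro N
      induction N with
      | zero => simp
      | succ N ih =>
        have hU : (⋃ i ≥ N, f i) = f N ∪ ⋃ i ≥ N + 1, f i := by
          ext x
          simp only [mem_iUnion, mem_union, exists_prop]
          constructor
          · rintro ⟨i, hi, hx⟩
            rcases hi.eq_or_lt with rfl | hi
            · exact .inl hx
            · exact .inr ⟨i, hi, hx⟩
          · rintro (hx | ⟨i, hi, hx⟩)
            · exact ⟨N, le_rfl, hx⟩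
            · exact ⟨i, by omega, hx⟩
        have hdis : Disjoint (f N) (⋃ i ≥ N + 1, f i) := by
          simp only [disjoint_iUnion_right]
          exact fun i hi => hd (by omega)
        rw [ih, hU, hadd _ _ (hf N) (.iUnion fun i => .iUnion fun _ => hf i) hdis,
          Finset.sum_range_succ, add_assoc]
    refine le_antisymm ?_ ?_
    -- Domination by the finite measure m makes the remainders vanish, which upgrades finite to
    -- countable additivity.
    · have hlim : Tendsto (fun N => ∑' i, L (f i) + K * m (⋃ i ≥ N, f i)) atTop
          (𝓝 (∑' i, L (f i) + K * 0)) :=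
        tendsto_const_nhds.add (ENNReal.Tendsto.const_mul
          (tendsto_measure_biUnion_Ici_zero_of_pairwise_disjoint
            (fun i => (hf i).nullMeasurableSet) hd) (.inr hK))
      rw [mul_zero, add_zero] at hlim
      refine ge_of_tendsto' hlim fun N => ?_
      rw [hsplit N]
      exact add_le_add (ENNReal.sum_le_tsum _)
        (hle _ (.iUnion fun i => .iUnion fun _ => hf i))
    · rw [ENNReal.tsum_eq_iSup_nat]
      refine iSup_le fun N => ?_
      rw [hsplit N]
      exact le_self_add
  refine ⟨Measure.ofMeasurable (fun A _ => L A) h0 fun f hf hd => hunion f hf hd, fun A hA => ?_⟩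
  rw [Measure.ofMeasurable_apply A hA]

/-- If the images of `m` under the iterates of `F` are uniformly dominated by `m`, then `F` has an
invariant measure dominated by `m`. -/
theorem exists_invariant_le [IsFiniteMeasure m] (hF : Measurable F) {K : ℝ≥0∞} (hK : K ≠ ∞)
    (h : ∀ n A, MeasurableSet A → m (F^[n] ⁻¹' A) ≤ K * m A) :
    ∃ μ : Measure X, MeasurePreserving F μ μ ∧ μ ≤ K • m ∧ μ univ = m univ := by
  set a : ℕ → Set X → ℝ≥0∞ :=
    fun n A => ((n + 1 : ℕ) : ℝ≥0∞)⁻¹ * ∑ k ∈ Finset.range (n + 1), m (F^[k] ⁻¹' A) with ha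
  -- Along an ultrafilter the averages converge for every set at once, as [0, ∞] is compact.
  set 𝒰 : Ultrafilter ℕ := hyperfilter ℕ
  have h𝒰 : (𝒰 : Filter ℕ) ≤ atTop := Nat.hyperfilter_le_atTop
  have hex : ∀ A, ∃ c, Tendsto (fun n => a n A) 𝒰 (𝓝 c) := fun A =>
    ⟨_, (𝒰.map fun n => a n A).le_nhds_lim⟩
  choose L hL using hex
  have hcancel : ∀ n : ℕ, ((n + 1 : ℕ) : ℝ≥0∞)⁻¹ * ((n + 1 : ℕ) : ℝ≥0∞) = 1 := fun n =>
    ENNReal.inv_mul_cancel (by simp) (ENNReal.natCast_ne_top _)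
  have hle : ∀ A, MeasurableSet A → L A ≤ K * m A := fun A hA => by
    refine le_of_tendsto' (hL A) fun n => ?_
    calc a n A ≤ ((n + 1 : ℕ) : ℝ≥0∞)⁻¹ * ∑ k ∈ Finset.range (n + 1), K * m A := by
          simp only [ha]
          gcongr with k
          exact h k A hA
      _ = K * m A := by
          rw [Finset.sum_const, Finset.card_range, nsmul_eq_mul, ← mul_assoc, hcancel, one_mul]
  have hadd : ∀ A B, MeasurableSet A → MeasurableSet B → Disjoint A B →
      L (A ∪ B) = L A + L B := fun A B _ hB hd => by
    refine tendsto_nhds_unique (hL _) (((hL A).add (hL B)).congr fun n => ?_)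
    simp only [ha, ← mul_add, ← Finset.sum_add_distrib]
    congr 1
    refine Finset.sum_congr rfl fun k _ => ?_
    rw [preimage_union, measure_union (hd.preimage _) ((hF.iterate k) hB)]
  obtain ⟨μ, hμ⟩ := exists_measure_of_additive_le hK L hle hadd
  have hzero : ∀ u : ℕ → Set X,
      Tendsto (fun n : ℕ => ((n + 1 : ℕ) : ℝ≥0∞)⁻¹ * m (u n)) 𝒰 (𝓝 0) := fun u => by
    have h1 : Tendsto (fun n : ℕ => ((n + 1 : ℕ) : ℝ≥0∞)⁻¹ * m univ) 𝒰 (𝓝 (0 * m univ)) :=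
      ENNReal.Tendsto.mul_const (((tendsto_add_atTop_iff_nat 1).2
        ENNReal.tendsto_inv_nat_nhds_zero).mono_left h𝒰) (.inr (measure_ne_top _ _))
    rw [zero_mul] at h1
    exact tendsto_of_tendsto_of_tendsto_of_le_of_le tendsto_const_nhds h1 (fun _ => zero_le)
      fun n => by gcongr; exact subset_univ _
  refine ⟨μ, ⟨hF, Measure.ext fun A hA => ?_⟩, Measure.le_iff.2 fun A hA => ?_, ?_⟩
  · rw [Measure.map_apply hF hA, hμ _ (hF hA), hμ _ hA]
    -- The averages for F⁻¹A and A differ by two end terms of order 1/n; one is added to each side,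
    -- avoiding subtraction.
    have h1 := (hL (F ⁻¹' A)).add (hzero fun _ => A)
    have h2 := (hL A).add (hzero fun n => F^[n + 1] ⁻¹' A)
    rw [add_zero] at h1 h2
    refine tendsto_nhds_unique h1 (h2.congr fun n => ?_)
    simp only [ha, ← mul_add]
    rw [← Finset.sum_range_succ (fun k => m (F^[k] ⁻¹' A)), Finset.sum_range_succ']
    simp only [Function.iterate_succ', preimage_comp, Function.iterate_zero, preimage_id]
  · rw [hμ A hA]
    exact hle A hA
  · rw [hμ _ .univ]
    refine tendsto_nhds_unique (hL _) (tendsto_const_nhds.congr fun n => ?_)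
    simp only [ha, preimage_univ, Finset.sum_const, Finset.card_range, nsmul_eq_mul]
    rw [← mul_assoc, hcancel, one_mul]

end InvariantMeasure

/-! ### Cylinders indexed by words -/

section Words

variable {X : Type*} {F : X → X} {P : Set (Set X)}

/-- The cylinder `ω₀ ∩ F⁻¹ ω₁ ∩ ⋯ ∩ F⁻⁽ⁿ⁻¹⁾ ωₙ₋₁` of a word `ω₀ ω₁ ⋯ ωₙ₋₁`. -/
def cyl (F : X → X) : List P → Set X
  | [] => univ
  | a :: l => (a : Set X) ∩ F ⁻¹' cyl F l

theorem cyl_cons (a : P) (l : List P) : cyl F (a :: l) = (a : Set X) ∩ F ⁻¹' cyl F l := rfl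

theorem cyl_cons_subset (a : P) (l : List P) : cyl F (a :: l) ⊆ a := inter_subset_left

theorem cyl_singleton (a : P) : cyl F [a] = a := by simp [cyl]

theorem cyl_append (l u : List P) : cyl F (l ++ u) = cyl F l ∩ F^[l.length] ⁻¹' cyl F u := by
  induction l with
  | nil => simp [cyl]
  | cons a l ih =>
    rw [List.cons_append, cyl_cons, ih, cyl_cons, preimage_inter, ← inter_assoc, List.length_cons,
      Function.iterate_succ, preimage_comp]

theorem iterate_succ_image (n : ℕ) (A : Set X) : F^[n + 1] '' A = F^[n] '' (F '' A) := by
  rw [Function.iterate_succ, image_comp]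

theorem image_cyl_cons (a : P) (l : List P) : F '' cyl F (a :: l) = F '' a ∩ cyl F l := by
  rw [cyl_cons, image_inter_preimage]

/-- This turns the Gibbs condition into a distortion bound that decays geometrically in the number
of letters still to be read. -/
theorem length_le_sepTime {l : List P} {x y : X} (hx : x ∈ cyl F l) (hy : y ∈ cyl F l) :
    (l.length : ℕ∞) ≤ sepTime F P x y := by
  refine le_iInf₂ fun n hn => ?_
  by_contra hlt
  rw [not_le, Nat.cast_lt] at hlt
  apply hn
  clear hn
  induction l generalizing n x y with
  | nil => simp at hlt
  | cons a l ih =>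
    cases n with
    | zero => exact ⟨a, a.2, hx.1, hy.1⟩
    | succ n =>
      rw [Function.iterate_succ_apply, Function.iterate_succ_apply]
      exact ih hx.2 hy.2 n (by simpa using hlt)

theorem cyl_disjoint (hP : P.PairwiseDisjoint id) {l l' : List P} (hl : l.length = l'.length)
    (hne : l ≠ l') : Disjoint (cyl F l) (cyl F l') := by
  rw [Set.disjoint_left]
  intro x hx hx'
  apply hne
  clear hne
  induction l generalizing x l' with
  | nil => exact (List.length_eq_zero_iff.1 hl.symm).symm
  | cons a l ih =>
    cases l' with
    | nil => simp at hl
    | cons b l' =>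
      have hab : a = b := by
        by_contra hab
        exact Set.disjoint_left.1 (hP a.2 b.2 fun h => hab (Subtype.ext h)) hx.1 hx'.1
      rw [hab, ih (by simpa using hl) hx.2 hx'.2]

/-- By disjointness each letter determines the position with respect to every element, so long
cylinders never cut a set decided by fewer iterates. -/
theorem mem_iff_mem_of_mem_cyl (hP : P.PairwiseDisjoint id) {l : List P} {x y : X}
    (hx : x ∈ cyl F l) (hy : y ∈ cyl F l) :
    ∀ i < l.length, ∀ ω ∈ P, F^[i] x ∈ ω ↔ F^[i] y ∈ ω := by
  induction l generalizing x y with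
  | nil => simp
  | cons a l ih =>
    rintro (_ | i) hi ω hω
    · have huniq : ∀ z ∈ (a : Set X), z ∈ ω → ω = a := fun z hz hzω => by
        by_contra hne
        exact Set.disjoint_left.1 (hP hω a.2 hne) hzω hz
      exact ⟨fun hxω => huniq x hx.1 hxω ▸ hy.1, fun hyω => huniq y hy.1 hyω ▸ hx.1⟩
    · rw [Function.iterate_succ_apply, Function.iterate_succ_apply]
      exact ih hx.2 hy.2 i (by simpa using hi) ω hω

theorem diff_image_inter_subset {n : ℕ} (b C G : Set X) :
    b \ F^[n] '' (C ∩ G) ⊆ (b \ F^[n] '' C) ∪ F^[n] '' (C \ G) := by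
  rintro y ⟨hyb, hy⟩
  by_cases hyC : y ∈ F^[n] '' C
  · obtain ⟨x, hx, rfl⟩ := hyC
    exact .inr ⟨x, ⟨hx, fun hxG => hy ⟨x, ⟨hx, hxG⟩, rfl⟩⟩, rfl⟩
  · exact .inl ⟨hyb, hyC⟩

theorem image_cyl_append_inter (l u : List P) (E : Set X) :
    F^[(l ++ u).length] '' (cyl F (l ++ u) ∩ E) =
      F^[u.length] '' (cyl F u ∩ F^[l.length] '' (cyl F l ∩ E)) := by
  rw [List.length_append, add_comm, Function.iterate_add, image_comp, cyl_append,
    ← image_preimage_inter]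
  congr 2
  ext x
  simp only [mem_inter_iff]
  tauto

end Words

/-! ### Distortion, Markov structure and null sets -/

section Maps

variable {X : Type*} [MeasurableSpace X] {m : Measure X} {F : X → X} {P : Set (Set X)}

theorem IsWGM.countable (h : IsWGM m F P) : Countable P := h.partition.countable.to_subtype

theorem IsWGM.measurableSet (h : IsWGM m F P) (a : P) : MeasurableSet (a : Set X) :=
  h.partition.measurableSet a a.2

theorem IsWGM.measurableSet_cyl (h : IsWGM m F P) (l : List P) : MeasurableSet (cyl F l) := by
  induction l with
  | nil => exact .univ
  | cons a l ih => exact (h.measurableSet a).inter (h.measurable ih)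

theorem IsWGM.measurableSet_image (h : IsWGM m F P) (a : P) {A : Set X} (hAa : A ⊆ a)
    (hA : MeasurableSet A) : MeasurableSet (F '' A) := by
  have := (h.invertible a a.2).measurableSet_image.2 (measurable_subtype_coe hA)
  convert this using 1
  ext y
  constructor
  · rintro ⟨x, hx, rfl⟩
    exact ⟨⟨x, hAa hx⟩, hx, rfl⟩
  · rintro ⟨⟨x, hxa⟩, hx, rfl⟩
    exact ⟨x, hx, rfl⟩

/-- Strict positivity of the Jacobian makes null sets travel both ways along a branch, so arguments
mod 0 survive taking images. -/
theorem IsWGM.measure_image_eq_zero_iff (h : IsWGM m F P) (a : P) {A : Set X} (hAa : A ⊆ a)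
    (hA : MeasurableSet A) : m (F '' A) = 0 ↔ m A = 0 := by
  obtain ⟨J, hJm, hJpos, hJ, -⟩ := h.gibbs
  rw [hJ a a.2 A hAa hA, lintegral_eq_zero_iff (hJm.ennreal_ofReal)]
  constructor
  · intro h0
    rw [← Measure.restrict_eq_zero, ← ae_eq_bot, ← empty_mem_iff_bot]
    filter_upwards [h0] with x hx
    simp only [Pi.zero_apply, ENNReal.ofReal_eq_zero] at hx
    exact absurd (hJpos x) hx.not_gt
  · intro h0
    rw [Measure.restrict_eq_zero.2 h0]
    exact ae_eq_bot.2 rfl ▸ eventually_bot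

theorem IsWGM.measurableSet_word_image (h : IsWGM m F P) (l : List P) {A : Set X}
    (hAl : A ⊆ cyl F l) (hA : MeasurableSet A) : MeasurableSet (F^[l.length] '' A) := by
  induction l generalizing A with
  | nil => simpa using hA
  | cons a l ih =>
    rw [List.length_cons, iterate_succ_image]
    refine ih ?_ (h.measurableSet_image a (hAl.trans (cyl_cons_subset a l)) hA)
    rintro _ ⟨x, hx, rfl⟩
    exact (hAl hx).2

theorem IsWGM.measure_word_image_eq_zero_iff (h : IsWGM m F P) (l : List P) {A : Set X}
    (hAl : A ⊆ cyl F l) (hA : MeasurableSet A) : m (F^[l.length] '' A) = 0 ↔ m A = 0 := by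
  induction l generalizing A with
  | nil => simp
  | cons a l ih =>
    have hAa := hAl.trans (cyl_cons_subset a l)
    rw [List.length_cons, iterate_succ_image, ih ?_ (h.measurableSet_image a hAa hA),
      h.measure_image_eq_zero_iff a hAa hA]
    rintro _ ⟨x, hx, rfl⟩
    exact (hAl hx).2

/-- Bounded distortion for one iterate, in terms of the separation time of the images. -/
theorem IsWGM.exists_distortion_one (h : IsWGM m F P) :
    ∃ C β : ℝ, 0 < C ∧ 0 < β ∧ β < 1 ∧ ∀ (a : P) (k : ℕ) (A B : Set X), A ⊆ a → B ⊆ a →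
      MeasurableSet A → MeasurableSet B →
      (∀ x ∈ A, ∀ y ∈ B, (k : ℕ∞) ≤ sepTime F P (F x) (F y)) →
      m (F '' A) * m B ≤ ENNReal.ofReal (Real.exp (C * β ^ k)) * (m A * m (F '' B)) := by
  obtain ⟨J, hJm, hJpos, hJ, C, β, hC, hβ, hβ1, hG⟩ := h.gibbs
  refine ⟨C, β, hC, hβ, hβ1, fun a k A B hAa hBa hA hB hk => ?_⟩
  set d := Real.exp (C * β ^ k) with hd
  have hpow : ∀ s : ℕ∞, (k : ℕ∞) ≤ s → powENat β s ≤ β ^ k := by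
    intro s hs
    unfold powENat
    split_ifs with hs'
    · positivity
    · refine pow_le_pow_of_le_one hβ.le hβ1.le ?_
      lift s to ℕ using hs'
      simpa using hs
  have hJle : ∀ x ∈ A, ∀ y ∈ B, J x ≤ d * J y := by
    intro x hx y hy
    have h1 : Real.log (J x / J y) ≤ C * β ^ k :=
      (hG a a.2 x (hAa hx) y (hBa hy)).trans
        (mul_le_mul_of_nonneg_left (hpow _ (hk x hx y hy)) hC.le)
    have h2 := (Real.log_le_iff_le_exp (div_pos (hJpos x) (hJpos y))).1 h1
    rwa [div_le_iff₀ (hJpos y)] at h2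
  rw [hJ a a.2 A hAa hA, hJ a a.2 B hBa hB]
  -- The pointwise comparison of Jacobians is integrated over x in A, then over y in B; no division
  -- is needed.
  have hstep : ∀ y ∈ B, ∫⁻ x in A, ENNReal.ofReal (J x) ∂m ≤
      ENNReal.ofReal d * m A * ENNReal.ofReal (J y) := by
    intro y hy
    calc ∫⁻ x in A, ENNReal.ofReal (J x) ∂m
        ≤ ∫⁻ _ in A, ENNReal.ofReal d * ENNReal.ofReal (J y) ∂m := by
          refine setLIntegral_mono' hA fun x hx => ?_
          rw [← ENNReal.ofReal_mul (Real.exp_pos _).le]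
          exact ENNReal.ofReal_le_ofReal (hJle x hx y hy)
      _ = ENNReal.ofReal d * m A * ENNReal.ofReal (J y) := by
          rw [setLIntegral_const]; ring
  calc (∫⁻ x in A, ENNReal.ofReal (J x) ∂m) * m B
      = ∫⁻ _ in B, (∫⁻ x in A, ENNReal.ofReal (J x) ∂m) ∂m := by rw [setLIntegral_const]
    _ ≤ ∫⁻ y in B, ENNReal.ofReal d * m A * ENNReal.ofReal (J y) ∂m :=
        setLIntegral_mono' hB hstep
    _ = ENNReal.ofReal d * (m A * ∫⁻ y in B, ENNReal.ofReal (J y) ∂m) := by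
        rw [lintegral_const_mul _ hJm.ennreal_ofReal, mul_assoc]

/-- Bounded distortion for all iterates. -/
theorem IsWGM.exists_distortion [IsFiniteMeasure m] (h : IsWGM m F P) :
    ∃ D : ℝ≥0∞, D ≠ ∞ ∧ ∀ (l : List P) (A B : Set X), A ⊆ cyl F l → B ⊆ cyl F l →
      MeasurableSet A → MeasurableSet B →
      m (F^[l.length] '' A) * m B ≤ D * (m A * m (F^[l.length] '' B)) := by
  obtain ⟨C, β, hC, hβ, hβ1, hd⟩ := h.exists_distortion_one
  have key : ∀ (l : List P) (A B : Set X), A ⊆ cyl F l → B ⊆ cyl F l →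
      MeasurableSet A → MeasurableSet B → m (F^[l.length] '' A) * m B ≤
        ENNReal.ofReal (Real.exp (C * ∑ i ∈ Finset.range l.length, β ^ i)) *
          (m A * m (F^[l.length] '' B)) := by
    intro l
    induction l with
    | nil => simp
    | cons a l ih =>
      intro A B hAl hBl hA hB
      have hAa := hAl.trans (cyl_cons_subset a l)
      have hBa := hBl.trans (cyl_cons_subset a l)
      have hFA : F '' A ⊆ cyl F l := by
        rintro _ ⟨x, hx, rfl⟩
        exact (hAl hx).2
      have hFB : F '' B ⊆ cyl F l := by
        rintro _ ⟨x, hx, rfl⟩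
        exact (hBl hx).2
      rw [List.length_cons, iterate_succ_image, iterate_succ_image]
      rcases eq_or_ne (m A) 0 with hA0 | hA0
      · have : m (F^[l.length] '' (F '' A)) = 0 := by
          rw [← iterate_succ_image]
          exact (h.measure_word_image_eq_zero_iff (a :: l) hAl hA).2 hA0
        rw [this, zero_mul]
        exact zero_le
      rcases eq_or_ne (m B) 0 with hB0 | hB0
      · rw [hB0, mul_zero]
        exact zero_le
      have h1 := ih (F '' A) (F '' B) hFA hFB (h.measurableSet_image a hAa hA)
        (h.measurableSet_image a hBa hB)
      -- The images still share the remaining word, so the first letter costs β to the power of its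
      -- length; the costs of all letters add up to a geometric sum.
      have h2 := hd a l.length A B hAa hBa hA hB
        fun x hx y hy => length_le_sepTime (hAl hx).2 (hBl hy).2
      have hA1 : m (F '' A) ≠ 0 := mt (h.measure_image_eq_zero_iff a hAa hA).1 hA0
      have hB1 : m (F '' B) ≠ 0 := mt (h.measure_image_eq_zero_iff a hBa hB).1 hB0
      rw [Finset.sum_range_succ, mul_add, Real.exp_add, ENNReal.ofReal_mul (Real.exp_pos _).le]
      -- The one-step bound and the inductive bound are multiplied and the intermediate measures
      -- cancelled; the null cases were removed for this.
      refine (ENNReal.mul_le_mul_iff_left (c := m (F '' A) * m (F '' B)) (mul_ne_zero hA1 hB1)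
        (ENNReal.mul_ne_top (measure_ne_top _ _) (measure_ne_top _ _))).1 ?_
      calc _ = (m (F^[l.length] '' (F '' A)) * m (F '' B)) * (m (F '' A) * m B) := by ring
        _ ≤ _ := mul_le_mul' h1 h2
        _ = _ := by ring
  refine ⟨ENNReal.ofReal (Real.exp (C * (1 - β)⁻¹)), ENNReal.ofReal_ne_top,
    fun l A B hAl hBl hA hB => (key l A B hAl hBl hA hB).trans ?_⟩
  gcongr
  rw [← tsum_geometric_of_lt_one hβ.le hβ1]
  exact (summable_geometric_of_lt_one hβ.le hβ1).sum_le_tsum _ fun i _ => by positivity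

/-- The image is a union of elements mod 0, and distinct elements are disjoint, so there is nothing
between containing b and missing it. -/
theorem IsWGM.subset_image_or_null (h : IsWGM m F P) (a b : P) :
    (b : Set X) ≤ᵐ[m] F '' a ∨ m (F '' a ∩ b) = 0 := by
  obtain ⟨Q, hQP, hQ⟩ := h.markov a a.2
  by_cases hb : (b : Set X) ∈ Q
  · left
    exact (LE.le.eventuallyLE (subset_sUnion_of_mem hb)).trans hQ.symm.le
  · right
    have h1 : (F '' a ∩ b : Set X) =ᵐ[m] (⋃₀ Q ∩ b : Set X) := hQ.inter (ae_eq_refl _)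
    have h2 : ⋃₀ Q ∩ b = ∅ := by
      rw [← Set.disjoint_iff_inter_eq_empty, Set.disjoint_sUnion_left]
      intro c hc
      refine h.partition.disjoint (hQP hc) b.2 ?_
      rintro rfl
      exact hb hc
    rw [measure_congr h1, h2, measure_empty]

/-- The image of a cylinder of positive measure is, up to a null set, the image of an element of
the partition. -/
theorem IsWGM.word_image (h : IsWGM m F P) {l : List P} (hl : l ≠ []) :
    m (cyl F l) = 0 ∨ ∃ a : P, F^[l.length] '' cyl F l =ᵐ[m] F '' a := by
  induction l with
  | nil => exact absurd rfl hl
  | cons a l ih =>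
    cases l with
    | nil =>
      right
      refine ⟨a, ?_⟩
      rw [cyl_singleton]
      rfl
    | cons b l =>
      rw [← h.measure_image_eq_zero_iff a (cyl_cons_subset a _) (h.measurableSet_cyl _),
        image_cyl_cons, List.length_cons, iterate_succ_image, image_cyl_cons]
      set c := cyl F (b :: l)
      have hc : MeasurableSet c := h.measurableSet_cyl _
      have hFa : MeasurableSet (F '' a) := h.measurableSet_image a subset_rfl (h.measurableSet a)
      rcases h.subset_image_or_null a b with hab | hab
      · rcases ih (by simp) with h0 | ⟨e, he⟩
        · exact .inl (measure_mono_null inter_subset_right h0)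
        · right
          refine ⟨e, .trans ?_ he⟩
          -- Here b lies in the image of a mod 0, so prefixing the letter a removes only a null set,
          -- whose further image is null too.
          have hnull : m (c \ F '' a) = 0 :=
            measure_mono_null (sdiff_subset_sdiff_left (cyl_cons_subset b l)) (ae_le_set.1 hab)
          have hnull' := (h.measure_word_image_eq_zero_iff (b :: l) sdiff_subset
            (hc.diff hFa)).2 hnull
          have hsplit : F^[(b :: l).length] '' c =
              F^[(b :: l).length] '' (F '' a ∩ c) ∪ F^[(b :: l).length] '' (c \ F '' a) := by
            rw [← image_union, inter_comm, inter_union_sdiff]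
          rw [hsplit]
          exact (union_ae_eq_left_of_ae_eq_empty (ae_eq_empty.2 hnull')).symm
      · exact .inl (measure_mono_null (inter_subset_inter_right _ (cyl_cons_subset b l)) hab)

theorem IsWGM.subset_word_image (h : IsWGM m F P) {l : List P} (hl : l ≠ []) (b : P)
    (hb : m (F^[l.length] '' cyl F l ∩ b) ≠ 0) : (b : Set X) ≤ᵐ[m] F^[l.length] '' cyl F l := by
  rcases h.word_image hl with h0 | ⟨a, ha⟩
  · exact absurd (measure_mono_null inter_subset_left
      ((h.measure_word_image_eq_zero_iff l subset_rfl (h.measurableSet_cyl l)).2 h0)) hb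
  · have h1 : (F^[l.length] '' cyl F l ∩ b : Set X) =ᵐ[m] (F '' a ∩ b : Set X) :=
      ha.inter (ae_eq_refl _)
    rw [measure_congr h1] at hb
    exact ((h.subset_image_or_null a b).resolve_right hb).trans ha.symm.le

theorem IsWGM.exists_le_measure_word_image (h : IsWGM m F P) :
    ∃ δ : ℝ≥0∞, δ ≠ 0 ∧ δ ≠ ∞ ∧ ∀ l : List P, l ≠ [] → m (cyl F l) ≠ 0 →
      δ ≤ m (F^[l.length] '' cyl F l) := by
  obtain ⟨δ, hδ, hd⟩ := h.longBranches
  -- The cap at 1 keeps the constant finite, so that it can be divided by.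
  refine ⟨min δ 1, (lt_min hδ one_pos).ne', (min_le_right _ _).trans_lt ENNReal.one_lt_top |>.ne,
    fun l hl h0 => (min_le_left _ _).trans ?_⟩
  obtain ⟨a, ha⟩ := (h.word_image hl).resolve_left h0
  rw [measure_congr ha]
  exact hd a a.2

theorem IsWGM.measure_ne_zero (h : IsWGM m F P) (a : P) : m (a : Set X) ≠ 0 := by
  obtain ⟨δ, hδ, hd⟩ := h.longBranches
  rw [Ne, ← h.measure_image_eq_zero_iff a subset_rfl (h.measurableSet a)]
  exact (hδ.trans_le (hd a a.2)).ne'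

theorem IsWGM.ae_exists_mem (h : IsWGM m F P) : ∀ᵐ x ∂m, ∃ a : P, x ∈ (a : Set X) := by
  filter_upwards [measure_eq_zero_iff_ae_notMem.1 h.partition.cover] with x hx
  simpa using hx

theorem IsWGM.quasiMeasurePreserving (h : IsWGM m F P) : Measure.QuasiMeasurePreserving F m m := by
  refine ⟨h.measurable, Measure.AbsolutelyContinuous.mk fun A hA hA0 => ?_⟩
  rw [Measure.map_apply h.measurable hA]
  have := h.countable
  have h1 : m (⋃ a : P, (a ∩ F ⁻¹' A : Set X)) = 0 := by
    refine measure_iUnion_null fun a => ?_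
    rw [← h.measure_image_eq_zero_iff a inter_subset_left
      ((h.measurableSet a).inter (h.measurable hA))]
    refine measure_mono_null ?_ hA0
    rw [image_inter_preimage]
    exact inter_subset_right
  refine measure_mono_null_ae ?_ h1
  filter_upwards [h.ae_exists_mem] with x hx hxA
  obtain ⟨a, ha⟩ := hx
  exact mem_iUnion.2 ⟨a, ha, hxA⟩

theorem IsWGM.ae_exists_mem_cyl (h : IsWGM m F P) (n : ℕ) :
    ∀ᵐ x ∂m, ∃ l : List P, l.length = n ∧ x ∈ cyl F l := by
  induction n with
  | zero => exact .of_forall fun x => ⟨[], rfl, mem_univ x⟩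
  | succ n ih =>
    filter_upwards [h.ae_exists_mem, h.quasiMeasurePreserving.ae ih] with x ⟨a, ha⟩ ⟨l, hl, hx⟩
    exact ⟨a :: l, by simp [hl], ha, hx⟩

/-- The measure of a set is the sum of the measures of its parts in the cylinders of length `n`. -/
theorem IsWGM.measure_eq_tsum (h : IsWGM m F P) (n : ℕ) {A : Set X} (hA : MeasurableSet A) :
    m A = ∑' l : {l : List P // l.length = n}, m (cyl F (l : List P) ∩ A) := by
  have := h.countable
  rw [← measure_iUnion]
  · refine measure_congr ?_
    filter_upwards [h.ae_exists_mem_cyl n] with x ⟨l, hl, hx⟩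
    refine propext ⟨fun hxA => mem_iUnion.2 ⟨⟨l, hl⟩, hx, hxA⟩, fun hxU => ?_⟩
    obtain ⟨i, hi⟩ := mem_iUnion.1 hxU
    exact hi.2
  · intro l l' hne
    exact (cyl_disjoint h.partition.disjoint (l.2.trans l'.2.symm)
      fun h => hne (Subtype.ext h)).mono inter_subset_left inter_subset_left
  · exact fun l => (h.measurableSet_cyl _).inter hA

end Maps

/-! ### Domination of the iterates and spreading of positive-measure sets -/

section Covering

variable {X : Type*} [MeasurableSpace X] {m : Measure X} {F : X → X} {P : Set (Set X)}

/-- The images of `m` under the iterates of `F` are uniformly dominated by `m`. -/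
theorem IsWGM.exists_measure_preimage_le [IsFiniteMeasure m] (h : IsWGM m F P) :
    ∃ K : ℝ≥0∞, K ≠ ∞ ∧ ∀ n A, MeasurableSet A → m (F^[n] ⁻¹' A) ≤ K * m A := by
  obtain ⟨D, hD, hdist⟩ := h.exists_distortion
  obtain ⟨δ, hδ0, hδ, hlong⟩ := h.exists_le_measure_word_image
  -- The quotient comes from distortion against whole cylinders, whose images have measure at least
  -- δ; the summand 1 covers n = 0.
  refine ⟨1 + D * m univ / δ, ENNReal.add_ne_top.2 ⟨ENNReal.one_ne_top, ENNReal.div_ne_top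
    (ENNReal.mul_ne_top hD (measure_ne_top _ _)) hδ0⟩, fun n A hA => ?_⟩
  rcases Nat.eq_zero_or_pos n with rfl | hn
  · rw [add_mul, one_mul]
    exact le_self_add
  have hAn : MeasurableSet (F^[n] ⁻¹' A) := (h.measurable.iterate n) hA
  have hl : ∀ l : {l : List P // l.length = n},
      δ * m (cyl F (l : List P) ∩ F^[n] ⁻¹' A) ≤ D * m A * m (cyl F (l : List P)) := by
    rintro ⟨l, rfl⟩
    dsimp only
    rcases eq_or_ne (m (cyl F l)) 0 with h0 | h0
    · rw [measure_mono_null inter_subset_left h0, mul_zero]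
      exact zero_le
    calc δ * m (cyl F l ∩ F^[l.length] ⁻¹' A)
        ≤ m (F^[l.length] '' cyl F l) * m (cyl F l ∩ F^[l.length] ⁻¹' A) := by
          gcongr
          exact hlong l (List.length_pos_iff.1 hn) h0
      _ ≤ D * (m (cyl F l) * m (F^[l.length] '' (cyl F l ∩ F^[l.length] ⁻¹' A))) :=
          hdist l _ _ subset_rfl inter_subset_left (h.measurableSet_cyl l)
            ((h.measurableSet_cyl l).inter hAn)
      _ ≤ D * (m (cyl F l) * m A) := by
          gcongr
          rw [image_inter_preimage]
          exact inter_subset_right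
      _ = D * m A * m (cyl F l) := by ring
  have hsum : δ * m (F^[n] ⁻¹' A) ≤ D * m A * m univ := by
    rw [h.measure_eq_tsum n hAn, h.measure_eq_tsum n .univ, ← ENNReal.tsum_mul_left,
      ← ENNReal.tsum_mul_left]
    simp only [inter_univ]
    exact ENNReal.tsum_le_tsum hl
  calc m (F^[n] ⁻¹' A) ≤ D * m A * m univ / δ := by
        rwa [ENNReal.le_div_iff_mul_le (.inl hδ0) (.inl hδ), mul_comm]
    _ = D * m univ / δ * m A := by
        simp only [div_eq_mul_inv]
        ring
    _ ≤ (1 + D * m univ / δ) * m A := by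
        gcongr
        exact le_add_self

/-- The sets determined by the positions of the first iterates with respect to `P`. -/
def itinerarySets (F : X → X) (P : Set (Set X)) : Set (Set X) :=
  {A | MeasurableSet A ∧ ∃ n : ℕ, ∀ x y : X,
    (∀ i < n, ∀ ω ∈ P, F^[i] x ∈ ω ↔ F^[i] y ∈ ω) → (x ∈ A ↔ y ∈ A)}

/-- Cylinders are not closed under unions or differences; sets decided by finitely many iterates
are, and approximation requires a ring. -/
theorem isSetRing_itinerarySets : IsSetRing (itinerarySets F P) where
  empty_mem := ⟨.empty, 0, fun _ _ _ => Iff.rfl⟩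
  union_mem := by
    rintro s t ⟨hs, n, hn⟩ ⟨ht, k, hk⟩
    refine ⟨hs.union ht, max n k, fun x y hxy => ?_⟩
    rw [mem_union, mem_union, hn x y fun i hi => hxy i (lt_max_of_lt_left hi),
      hk x y fun i hi => hxy i (lt_max_of_lt_right hi)]
  sdiff_mem := by
    rintro s t ⟨hs, n, hn⟩ ⟨ht, k, hk⟩
    refine ⟨hs.diff ht, max n k, fun x y hxy => ?_⟩
    rw [Set.mem_sdiff, Set.mem_sdiff, hn x y fun i hi => hxy i (lt_max_of_lt_left hi),
      hk x y fun i hi => hxy i (lt_max_of_lt_right hi)]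

theorem IsWGM.cylinders_subset_itinerarySets (h : IsWGM m F P) (n : ℕ) :
    cylinders F P n ⊆ itinerarySets F P := by
  rintro _ ⟨ω, hω, rfl⟩
  refine ⟨.iInter fun i => (h.measurable.iterate _) (h.partition.measurableSet _ (hω i)), n,
    fun x y hxy => ?_⟩
  simp only [mem_iInter, mem_preimage]
  exact forall_congr' fun i => hxy i i.2 _ (hω i)

/-- A set which agrees almost everywhere with an element of the σ-algebra generated by a ring of
measurable sets is approximated by elements of the ring. -/
theorem exists_symmDiff_lt_of_isSetRing [IsFiniteMeasure m] {C : Set (Set X)} (hC : IsSetRing C)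
    (hCm : ∀ A ∈ C, MeasurableSet A) (huniv : univ ∈ C) {E B : Set X}
    (hB : MeasurableSet[MeasurableSpace.generateFrom C] B) (hEB : E =ᵐ[m] B) {ε : ℝ≥0∞}
    (hε : 0 < ε) : ∃ t ∈ C, m (symmDiff t E) < ε := by
  have hle := MeasurableSpace.generateFrom_le hCm
  -- The measure is trimmed because the cylinders generate the σ-algebra only mod 0.
  obtain ⟨t, ht, htB⟩ := @exists_measure_symmDiff_lt_of_generateFrom_isSetRing X
    (MeasurableSpace.generateFrom C) (m.trim hle) _ C hC
    ⟨{univ}, countable_singleton _, singleton_subset_iff.2 huniv, by simp⟩ rfl B hB ε hε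
  refine ⟨t, ht, ?_⟩
  have ht' := MeasurableSpace.measurableSet_generateFrom ht
  have htB' := @MeasurableSet.symmDiff X (MeasurableSpace.generateFrom C) t B ht' hB
  rw [trim_measurableSet_eq hle htB'] at htB
  rwa [measure_congr ((ae_eq_refl t).symmDiff hEB)]

/-- Measurable sets are approximated by sets determined by finitely many iterates. -/
theorem IsWGM.exists_symmDiff_lt [IsFiniteMeasure m] (h : IsWGM m F P) {E : Set X}
    (hE : MeasurableSet E) {ε : ℝ≥0∞} (hε : 0 < ε) :
    ∃ t ∈ itinerarySets F P, m (symmDiff t E) < ε := by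
  obtain ⟨B, hB, hEB⟩ := h.separability.1 E hE
  refine exists_symmDiff_lt_of_isSetRing isSetRing_itinerarySets (fun A hA => hA.1)
    ⟨.univ, 0, fun _ _ _ => Iff.rfl⟩ (MeasurableSpace.generateFrom_mono ?_ B hB) hEB hε
  rintro C ⟨n, -, hC⟩
  exact h.cylinders_subset_itinerarySets n hC

/-- Every set of positive measure fills a cylinder up to an arbitrarily small proportion. -/
theorem IsWGM.exists_cyl_diff_le [IsFiniteMeasure m] (h : IsWGM m F P) {E : Set X}
    (hE : MeasurableSet E) (hE0 : m E ≠ 0) {η : ℝ≥0∞} (hη0 : η ≠ 0) (hη : η ≠ ∞) :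
    ∃ l : List P, l ≠ [] ∧ m (cyl F l) ≠ 0 ∧ m (cyl F l \ E) ≤ η * m (cyl F l) := by
  by_contra! hcon
  have hcon' : ∀ l : List P, l ≠ [] → η * m (cyl F l) ≤ m (cyl F l \ E) := by
    intro l hl
    rcases eq_or_ne (m (cyl F l)) 0 with h0 | h0
    · rw [h0, mul_zero]
      exact zero_le
    · exact (hcon l hl h0).le
  -- If E missed the proportion η of every cylinder, it would miss that proportion of its
  -- approximant t, which is impossible once ε(1 + η) < η m(E).
  obtain ⟨ε, hε, hlt⟩ := ENNReal.exists_nnreal_pos_mul_lt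
    (ENNReal.add_ne_top.2 ⟨ENNReal.one_ne_top, hη⟩) (mul_ne_zero hη0 hE0)
  obtain ⟨t, ⟨ht, n, hn⟩, htE⟩ := h.exists_symmDiff_lt hE (ENNReal.coe_pos.2 hε)
  have hsum : η * m t ≤ m (t \ E) := by
    -- Length n + 1 instead of n guarantees nonempty words.
    rw [h.measure_eq_tsum (n + 1) ht, h.measure_eq_tsum (n + 1) (ht.diff hE),
      ← ENNReal.tsum_mul_left]
    refine ENNReal.tsum_le_tsum ?_
    rintro ⟨l, hl⟩
    dsimp only
    rcases (cyl F l ∩ t).eq_empty_or_nonempty with h0 | ⟨x, hx, hxt⟩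
    · rw [h0, measure_empty, mul_zero]
      exact zero_le
    · have hsub : cyl F l ⊆ t := fun y hy =>
        (hn x y fun i hi => mem_iff_mem_of_mem_cyl h.partition.disjoint hx hy i (by omega)).1 hxt
      rw [inter_eq_left.2 hsub, ← inter_sdiff_assoc, inter_eq_left.2 hsub]
      exact hcon' l (by rintro rfl; simp at hl)
  refine hlt.not_ge ?_
  calc η * m E ≤ η * (m t + m (symmDiff t E)) := by
        gcongr
        refine (measure_mono ?_).trans (measure_union_le _ _)
        intro x hx
        by_cases hxt : x ∈ t
        · exact .inl hxt
        · exact .inr (.inr ⟨hx, hxt⟩)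
    _ = η * m t + η * m (symmDiff t E) := mul_add _ _ _
    _ ≤ ε + η * ε := by
        gcongr
        exact hsum.trans ((measure_mono subset_union_left).trans htE.le)
    _ = ε * (1 + η) := by ring

/-- Distortion against the whole cylinder bounds the expansion. The constant depends on the word,
hence the later reduction to finitely many words. -/
theorem IsWGM.exists_measure_word_image_le [IsFiniteMeasure m] (h : IsWGM m F P) (l : List P) :
    ∃ K : ℝ≥0∞, K ≠ ∞ ∧ ∀ A ⊆ cyl F l, MeasurableSet A → m (F^[l.length] '' A) ≤ K * m A := by
  obtain ⟨D, hD, hdist⟩ := h.exists_distortion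
  rcases eq_or_ne (m (cyl F l)) 0 with h0 | h0
  · refine ⟨0, ENNReal.zero_ne_top, fun A hAl hA => ?_⟩
    rw [(h.measure_word_image_eq_zero_iff l hAl hA).2 (measure_mono_null hAl h0)]
    exact zero_le
  · refine ⟨D * m univ / m (cyl F l), ENNReal.div_ne_top
      (ENNReal.mul_ne_top hD (measure_ne_top _ _)) h0, fun A hAl hA => ?_⟩
    calc m (F^[l.length] '' A) ≤ D * (m A * m univ) / m (cyl F l) := by
          rw [ENNReal.le_div_iff_mul_le (.inl h0) (.inl (measure_ne_top _ _))]
          refine (hdist l A _ hAl subset_rfl hA (h.measurableSet_cyl l)).trans ?_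
          gcongr
          exact subset_univ _
      _ = D * m univ / m (cyl F l) * m A := by
          simp only [div_eq_mul_inv]
          ring

theorem measure_diff_image_inter_le {n : ℕ} {b C : Set X} (hb : b ≤ᵐ[m] F^[n] '' C) (G : Set X) :
    m (b \ F^[n] '' (C ∩ G)) ≤ m (F^[n] '' (C \ G)) := by
  refine (measure_mono (diff_image_inter_subset b C G)).trans ((measure_union_le _ _).trans ?_)
  rw [ae_le_set.1 hb, zero_add]

theorem IsWGM.exists_measure_diff_word_image_le [IsFiniteMeasure m] (h : IsWGM m F P)
    {u : List P} {b : Set X} (hb : b ≤ᵐ[m] F^[u.length] '' cyl F u) :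
    ∃ K : ℝ≥0∞, K ≠ ∞ ∧ ∀ G, MeasurableSet G →
      m (b \ F^[u.length] '' (cyl F u ∩ G)) ≤ K * m (cyl F u \ G) := by
  obtain ⟨K, hK, hle⟩ := h.exists_measure_word_image_le u
  exact ⟨K, hK, fun G hG => (measure_diff_image_inter_le hb G).trans
    (hle _ sdiff_subset ((h.measurableSet_cyl u).diff hG))⟩

/-- Under aperiodicity, any two elements of the partition are joined by a word. -/
theorem IsWGM.exists_connecting_word (h : IsWGM m F P) (haper : IsAperiodic m F P) (a b : P) :
    ∃ l : List P, l ≠ [] ∧ cyl F l ⊆ a ∧ (b : Set X) ≤ᵐ[m] F^[l.length] '' cyl F l := by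
  obtain ⟨k, hk⟩ := haper a a.2 b b.2
  have hpos := hk (k + 1) (by omega)
  have hbm := (h.measurable.iterate (k + 1)) (h.measurableSet b)
  rw [h.measure_eq_tsum (k + 1) ((h.measurableSet a).inter hbm)] at hpos
  obtain ⟨⟨l, hl⟩, hl0⟩ := not_forall.1 (mt ENNReal.tsum_eq_zero.2 hpos.ne')
  dsimp only at hl0
  have hne : l ≠ [] := by
    rintro rfl
    simp at hl
  refine ⟨l, hne, ?_, h.subset_word_image hne b ?_⟩
  · obtain ⟨x, hx, hxa, -⟩ := nonempty_of_measure_ne_zero hl0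
    cases l with
    | nil => exact absurd rfl hne
    | cons c l =>
      have hca : c = a := by
        by_contra hca
        exact Set.disjoint_left.1
          (h.partition.disjoint c.2 a.2 fun h => hca (Subtype.ext h)) hx.1 hxa
      exact hca ▸ cyl_cons_subset c l
  · rw [← image_inter_preimage, Ne, h.measure_word_image_eq_zero_iff l inter_subset_left
      ((h.measurableSet_cyl l).inter (hl ▸ hbm))]
    refine mt (measure_mono_null ?_) hl0
    rw [hl]
    exact inter_subset_inter_right _ inter_subset_right

/-- Finitely many elements of the partition carry all but a small part of the measure. -/
theorem IsWGM.exists_finset_tsum_lt [IsFiniteMeasure m] (h : IsWGM m F P) {δ : ℝ≥0∞}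
    (hδ : δ ≠ 0) : ∃ S : Finset P, ∀ W : Set X, δ ≤ m W → ∃ a ∈ S, m (W ∩ a) ≠ 0 := by
  have := h.countable
  have hfin : ∑' a : P, m (a : Set X) ≠ ∞ := by
    have hd : Pairwise (Function.onFun Disjoint fun a : P => (a : Set X)) := fun a b hab =>
      h.partition.disjoint a.2 b.2 fun h => hab (Subtype.ext h)
    rw [← measure_iUnion hd h.measurableSet]
    exact measure_ne_top _ _
  obtain ⟨S, hS⟩ := ((ENNReal.tendsto_tsum_compl_atTop_zero hfin).eventually_lt_const
    (pos_iff_ne_zero.2 hδ)).exists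
  refine ⟨S, fun W hW => ?_⟩
  by_contra! hcon
  refine (hW.trans ?_).not_gt hS
  have h0 : m (⋃ a ∈ S, W ∩ (a : Set X)) = 0 :=
    (measure_biUnion_null_iff S.countable_toSet).2 hcon
  calc m W ≤ m (⋃ a : {a // a ∉ S}, ((a : P) : Set X)) := by
        refine measure_mono_ae ?_
        filter_upwards [h.ae_exists_mem, measure_eq_zero_iff_ae_notMem.1 h0] with x ⟨a, ha⟩ hx hxW
        refine mem_iUnion.2 ⟨⟨a, fun haS => hx ?_⟩, ha⟩
        exact mem_iUnion₂.2 ⟨a, haS, hxW, ha⟩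
    _ ≤ _ := measure_iUnion_le _

/-- Every set of positive measure is spread by a suitable word over almost all of a given element
of the partition. -/
theorem IsWGM.exists_word_measure_diff_le [IsFiniteMeasure m] (h : IsWGM m F P)
    (haper : IsAperiodic m F P) (b : P) {E : Set X} (hE : MeasurableSet E) (hE0 : m E ≠ 0)
    {ε : ℝ≥0∞} (hε : ε ≠ 0) :
    ∃ l : List P, m (b \ F^[l.length] '' (cyl F l ∩ E)) ≤ ε := by
  obtain ⟨D, hD, hdist⟩ := h.exists_distortion
  obtain ⟨δ, hδ0, hδ, hlong⟩ := h.exists_le_measure_word_image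
  -- S is fixed before the proportion η: whatever cylinder E fills, its image meets some element of
  -- S, so finitely many connecting words to b suffice.
  obtain ⟨S, hS⟩ := h.exists_finset_tsum_lt hδ0
  choose v hv0 hva hvb using fun a : P => h.exists_connecting_word haper a b
  choose K hK hKle using fun a : P => h.exists_measure_diff_word_image_le (hvb a)
  have hKfin : (∑ a ∈ S, K a) * (D * m univ) ≠ ∞ :=
    ENNReal.mul_ne_top (ENNReal.sum_ne_top.2 fun a _ => hK a)
      (ENNReal.mul_ne_top hD (measure_ne_top _ _))
  obtain ⟨η, hη, hlt⟩ := ENNReal.exists_nnreal_pos_mul_lt hKfin hε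
  obtain ⟨l, hl, hl0, hlE⟩ := h.exists_cyl_diff_le hE hE0
    (ENNReal.coe_ne_zero.2 hη.ne') ENNReal.coe_ne_top
  obtain ⟨a, haS, ha⟩ := hS _ (hlong l hl hl0)
  have hal := h.subset_word_image hl a ha
  have hcl := h.measurableSet_cyl l
  -- Distortion turns the small missed proportion of the cylinder into a small missed measure in its
  -- image.
  have himg : m (F^[l.length] '' (cyl F l \ E)) ≤ η * (D * m univ) := by
    refine (ENNReal.mul_le_mul_iff_left hl0 (measure_ne_top _ _)).1 ?_
    calc m (F^[l.length] '' (cyl F l \ E)) * m (cyl F l)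
        ≤ D * (m (cyl F l \ E) * m (F^[l.length] '' cyl F l)) :=
          hdist l _ _ sdiff_subset subset_rfl (hcl.diff hE) hcl
      _ ≤ D * (η * m (cyl F l) * m univ) := by
          gcongr
          exact subset_univ _
      _ = η * (D * m univ) * m (cyl F l) := by ring
  refine ⟨l ++ v a, ?_⟩
  rw [image_cyl_append_inter]
  set G := F^[l.length] '' (cyl F l ∩ E)
  have hG : MeasurableSet G := h.measurableSet_word_image l inter_subset_left (hcl.inter hE)
  calc m (b \ F^[(v a).length] '' (cyl F (v a) ∩ G)) ≤ K a * m (cyl F (v a) \ G) := hKle a G hG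
    _ ≤ (∑ a ∈ S, K a) * (η * (D * m univ)) := by
        gcongr
        · exact Finset.single_le_sum (fun _ _ => zero_le) haS
        · exact (measure_mono (sdiff_subset_sdiff_left (hva a))).trans
            ((measure_diff_image_inter_le hal E).trans himg)
    _ = η * ((∑ a ∈ S, K a) * (D * m univ)) := by ring
    _ ≤ ε := hlt.le

end Covering

/-! ### Orbits and levels of the tower -/

section TowerSets

variable {X : Type*} {F : X → X} {P : Set (Set X)} {R : X → ℕ}

/-- The base point of the tower above `x`. -/
def toBase (hR : ∀ x, 0 < R x) (x : X) : Tower R := ⟨(x, 0), hR x⟩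

theorem towerMap_iterate_toBase (hR : ∀ x, 0 < R x) (x : X) {ℓ : ℕ} (hℓ : ℓ < R x) :
    (towerMap F R hR)^[ℓ] (toBase hR x) = ⟨(x, ℓ), hℓ⟩ := by
  induction ℓ with
  | zero => rfl
  | succ ℓ ih => rw [Function.iterate_succ_apply', ih (by omega), towerMap, dif_pos hℓ]

theorem towerMap_iterate_return (hR : ∀ x, 0 < R x) (x : X) :
    (towerMap F R hR)^[R x] (toBase hR x) = toBase hR (F x) := by
  obtain ⟨k, hk⟩ := Nat.exists_eq_succ_of_ne_zero (hR x).ne'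
  rw [hk, Nat.succ_eq_add_one, Function.iterate_succ_apply',
    towerMap_iterate_toBase hR x (by omega), towerMap, dif_neg (by dsimp only; omega)]
  rfl

/-- If the return time is `r i` on the element `ω i`, then the `n`-th return from a cylinder of
length `n` takes the sum of these times. -/
theorem towerMap_iterate_cyl_map (hR : ∀ x, 0 < R x) {ι : Type*} {ω : ι → P} {r : ι → ℕ}
    (hr : ∀ i, ∀ x ∈ (ω i : Set X), R x = r i) (l : List ι) {x : X} (hx : x ∈ cyl F (l.map ω)) :
    (towerMap F R hR)^[(l.map r).sum] (toBase hR x) = toBase hR (F^[l.length] x) := by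
  induction l generalizing x with
  | nil => rfl
  | cons i l ih =>
    rw [List.map_cons, List.sum_cons, add_comm, Function.iterate_add_apply, ← hr i x hx.1,
      towerMap_iterate_return, ih hx.2]
    rfl

/-- The duration τ depends on the word alone, so all points of a cylinder are back at the base
simultaneously. -/
theorem exists_towerMap_iterate_cyl (hR : ∀ x, 0 < R x)
    (hconst : ∀ ω ∈ P, ∀ x ∈ ω, ∀ y ∈ ω, R x = R y) (l : List P) :
    ∃ τ : ℕ, ∀ x ∈ cyl F l,
      (towerMap F R hR)^[τ] (toBase hR x) = toBase hR (F^[l.length] x) := by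
  have hex : ∀ a : P, ∃ r, ∀ x ∈ (a : Set X), R x = r := by
    intro a
    rcases (a : Set X).eq_empty_or_nonempty with h0 | ⟨y, hy⟩
    · exact ⟨0, by simp [h0]⟩
    · exact ⟨R y, fun x hx => hconst a a.2 x hx y hy⟩
  choose r hr using hex
  refine ⟨(l.map r).sum, fun x hx => ?_⟩
  exact towerMap_iterate_cyl_map hR (ω := id) hr l (by simpa using hx)

/-- The set of points of the base which lie below a point of `A` at the level `ℓ`. -/
def level (A : Set (Tower R)) (ℓ : ℕ) : Set X := {x | ∃ h : ℓ < R x, (⟨(x, ℓ), h⟩ : Tower R) ∈ A}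

theorem level_eq (A : Set (Tower R)) (ℓ : ℕ) :
    level A ℓ = (fun x => (x, ℓ)) ⁻¹' (Subtype.val '' A) := by
  ext x
  simp [level]

end TowerSets

/-! ### Lifting measures to the tower -/

section TowerMeasure

variable {X : Type*} [MeasurableSpace X] {m μ : Measure X} {F : X → X} {R : X → ℕ}

theorem measurableSet_tower (hRm : Measurable R) : MeasurableSet {p : X × ℕ | p.2 < R p.1} :=
  measurableSet_lt measurable_snd (hRm.comp measurable_fst)

theorem measurable_toBase (hR : ∀ x, 0 < R x) : Measurable (toBase hR) :=
  (measurable_id.prodMk measurable_const).subtype_mk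

theorem measurableSet_level (hRm : Measurable R) {A : Set (Tower R)} (hA : MeasurableSet A)
    (ℓ : ℕ) : MeasurableSet (level A ℓ) := by
  rw [level_eq]
  exact (measurable_id.prodMk measurable_const) ((measurableSet_tower hRm).subtype_image hA)

theorem towerMeasure_apply [SFinite m] (hRm : Measurable R) {A : Set (Tower R)}
    (hA : MeasurableSet A) : towerMeasure m R A = ∑' ℓ, m (level A ℓ) := by
  have hemb : MeasurableEmbedding (Subtype.val : Tower R → X × ℕ) :=
    .subtype_coe (measurableSet_tower hRm)
  have hA' := hemb.measurableSet_image.2 hA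
  rw [towerMeasure, hemb.comap_apply,
    Measure.prod_apply_symm hA', lintegral_count]
  simp only [level_eq]

theorem measurable_towerMap (hF : Measurable F) (hRm : Measurable R) (hR : ∀ x, 0 < R x) :
    Measurable (towerMap F R hR) := by
  have hfst : Measurable fun p : Tower R => p.1.1 := measurable_fst.comp measurable_subtype_coe
  have hsnd : Measurable fun p : Tower R => p.1.2 := measurable_snd.comp measurable_subtype_coe
  have hS : MeasurableSet {p : Tower R | p.1.2 + 1 < R p.1.1} :=
    measurableSet_lt (hsnd.add_const 1) (hRm.comp hfst)
  have hval : Measurable fun p : Tower R => ((towerMap F R hR p : Tower R) : X × ℕ) := by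
    have : (fun p : Tower R => ((towerMap F R hR p : Tower R) : X × ℕ)) =
        fun p : Tower R => if p.1.2 + 1 < R p.1.1 then (p.1.1, p.1.2 + 1) else (F p.1.1, 0) := by
      funext p
      unfold towerMap
      split_ifs <;> rfl
    rw [this]
    exact Measurable.ite hS (hfst.prodMk (hsnd.add_const 1))
      ((hF.comp hfst).prodMk measurable_const)
  exact hval.subtype_mk (h := fun p => (towerMap F R hR p).2)

/-- The tower measure over an invariant measure is invariant. -/
theorem measurePreserving_towerMap [IsFiniteMeasure μ] (hF : MeasurePreserving F μ μ)
    (hRm : Measurable R) (hR : ∀ x, 0 < R x) :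
    MeasurePreserving (towerMap F R hR) (towerMeasure μ R) (towerMeasure μ R) := by
  have hT := measurable_towerMap hF.measurable hRm hR
  refine ⟨hT, Measure.ext fun A hA => ?_⟩
  rw [Measure.map_apply hT hA, towerMeasure_apply hRm (hT hA), towerMeasure_apply hRm hA]
  -- A point of level ℓ either climbs to level ℓ + 1 or, when its return time is ℓ + 1, falls to the
  -- base; summed over ℓ, the second parts make up the F-preimage of the base level.
  have hlev : ∀ ℓ, μ (level (towerMap F R hR ⁻¹' A) ℓ) =
      μ (level A (ℓ + 1)) + μ ({x | R x = ℓ + 1} ∩ F ⁻¹' level A 0) := by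
    intro ℓ
    rw [← measure_union]
    · congr 1
      ext x
      simp only [level, mem_ofPred_eq, mem_preimage, mem_union, mem_inter_iff]
      constructor
      · rintro ⟨h, hx⟩
        by_cases hlt : ℓ + 1 < R x
        · rw [towerMap, dif_pos hlt] at hx
          exact .inl ⟨hlt, hx⟩
        · rw [towerMap, dif_neg hlt] at hx
          exact .inr ⟨by omega, hR _, hx⟩
      · rintro (⟨hlt, hx⟩ | ⟨heq, h0, hx⟩)
        · refine ⟨by omega, ?_⟩
          rwa [towerMap, dif_pos hlt]
        · refine ⟨by omega, ?_⟩
          rwa [towerMap, dif_neg (by dsimp only; omega)]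
    · rw [Set.disjoint_left]
      rintro x ⟨hlt, -⟩ ⟨heq, -⟩
      simp only [mem_ofPred_eq] at heq
      omega
    · exact (hRm (measurableSet_singleton _)).inter (hF.measurable (measurableSet_level hRm hA 0))
  have hbase : ∑' ℓ : ℕ, μ ({x | R x = ℓ + 1} ∩ F ⁻¹' level A 0) = μ (level A 0) := by
    rw [← hF.measure_preimage (measurableSet_level hRm hA 0).nullMeasurableSet, ← measure_iUnion]
    · congr 1
      ext x
      simp only [mem_iUnion, mem_inter_iff, mem_ofPred_eq, exists_and_right, and_iff_right_iff_imp]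
      exact fun _ => ⟨R x - 1, by have := hR x; omega⟩
    · intro i j hij
      refine Set.disjoint_left.2 ?_
      rintro x ⟨hi, -⟩ ⟨hj, -⟩
      simp only [mem_ofPred_eq] at hi hj
      omega
    · exact fun ℓ => (hRm (measurableSet_singleton _)).inter
        (hF.measurable (measurableSet_level hRm hA 0))
  simp_rw [hlev]
  rw [ENNReal.tsum_add, hbase, add_comm]
  exact (tsum_eq_zero_add' (f := fun ℓ => μ (level A ℓ)) ENNReal.summable).symm

theorem towerMeasure_univ [SFinite m] (hRm : Measurable R) :
    towerMeasure m R univ = ∫⁻ x, (R x : ℝ≥0∞) ∂m := by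
  rw [towerMeasure_apply hRm .univ]
  have : ∀ x, (R x : ℝ≥0∞) = ∑' ℓ : ℕ, {x | ℓ < R x}.indicator (fun _ => (1 : ℝ≥0∞)) x := by
    intro x
    rw [tsum_eq_sum (s := Finset.range (R x))]
    · rw [Finset.sum_congr rfl (g := fun _ => (1 : ℝ≥0∞))]
      · simp
      · intro ℓ hℓ
        exact indicator_of_mem (by simpa using hℓ) _
    · intro ℓ hℓ
      exact indicator_of_notMem (by simpa using hℓ) _
  have hm : ∀ ℓ : ℕ, MeasurableSet {x | ℓ < R x} := fun ℓ => measurableSet_lt measurable_const hRm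
  simp_rw [this]
  rw [lintegral_tsum fun ℓ => (measurable_const.indicator (hm ℓ)).aemeasurable]
  refine tsum_congr fun ℓ => ?_
  rw [lintegral_indicator_const (hm ℓ), one_mul]
  simp [level]

theorem towerMeasure_absolutelyContinuous [SFinite m] [SFinite μ] (h : μ ≪ m)
    (hRm : Measurable R) : towerMeasure μ R ≪ towerMeasure m R := by
  refine Measure.AbsolutelyContinuous.mk fun A hA h0 => ?_
  rw [towerMeasure_apply hRm hA, ENNReal.tsum_eq_zero] at *
  exact fun ℓ => h (h0 ℓ)

/-- An invariant measure on the base dominated by `m` yields, when the return time is integrable,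
an absolutely continuous invariant probability measure on the tower. -/
theorem exists_isACIP_tower [IsFiniteMeasure m] (hF : MeasurePreserving F μ μ) {K : ℝ≥0∞}
    (hK : K ≠ ∞) (hμ : μ ≤ K • m) (hμ0 : μ univ ≠ 0) (hRm : Measurable R) (hR : ∀ x, 0 < R x)
    (hint : Integrable (fun x => (R x : ℝ)) m) :
    ∃ ν, IsACIP (towerMap F R hR) (towerMeasure m R) ν := by
  have hac : μ ≪ m := Measure.absolutelyContinuous_of_le_smul hμ
  have hfin : IsFiniteMeasure μ := ⟨(Measure.le_iff'.1 hμ univ).trans_lt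
    (ENNReal.mul_lt_top hK.lt_top (measure_lt_top m univ))⟩
  have hlt : towerMeasure μ R univ ≠ ∞ := by
    rw [towerMeasure_univ hRm]
    refine ((lintegral_mono' hμ le_rfl).trans_lt ?_).ne
    rw [lintegral_smul_measure]
    refine ENNReal.mul_lt_top hK.lt_top ?_
    have := hint.hasFiniteIntegral
    rw [hasFiniteIntegral_iff_enorm] at this
    refine lt_of_eq_of_lt (lintegral_congr fun x => ?_) this
    simp
  have hne : towerMeasure μ R univ ≠ 0 := by
    rw [towerMeasure_univ hRm]
    refine ((pos_iff_ne_zero.2 hμ0).trans_le ?_).ne'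
    rw [← lintegral_one]
    refine lintegral_mono fun x => ?_
    exact Nat.one_le_cast.2 (hR x)
  refine ⟨(towerMeasure μ R univ)⁻¹ • towerMeasure μ R, ⟨?_⟩, ?_, ?_⟩
  · rw [Measure.smul_apply, smul_eq_mul, ENNReal.inv_mul_cancel hne hlt]
  · exact (measurePreserving_towerMap hF hRm hR).smul_measure _
  · exact (towerMeasure_absolutelyContinuous hac hRm).smul_left _

end TowerMeasure

/-! ### Triviality of tail sets -/

section TailTriviality

variable {X : Type*} [MeasurableSpace X] {m : Measure X} {F : X → X} {P : Set (Set X)} {R : X → ℕ}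

/-- Each block element covers the whole block, so block letters may be concatenated in any order. -/
theorem IsWGM.iUnion_le_block_word_image (h : IsWGM m F P) {ι : Type*} {ω : ι → P}
    (hω : ∀ i, (⋃ j, (ω j : Set X)) ≤ᵐ[m] F '' ω i) (l : List ι) (i : ι) :
    (⋃ j, (ω j : Set X)) ≤ᵐ[m] F^[((i :: l).map ω).length] '' cyl F ((i :: l).map ω) := by
  induction l generalizing i with
  | nil =>
    rw [List.map_singleton, cyl_singleton]
    exact hω i
  | cons j l ih =>
    set w := (j :: l).map ω with hw
    have hc := h.measurableSet_cyl w
    have hFi : MeasurableSet (F '' ω i) := h.measurableSet_image _ subset_rfl (h.measurableSet _)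
    have hsub : cyl F w ⊆ ⋃ j, (ω j : Set X) :=
      (cyl_cons_subset (ω j) (l.map ω)).trans (subset_iUnion (fun j => (ω j : Set X)) j)
    have hnull : m (cyl F w \ F '' ω i) = 0 :=
      measure_mono_null (sdiff_subset_sdiff_left hsub) (ae_le_set.1 (hω i))
    rw [List.map_cons, List.length_cons, iterate_succ_image, image_cyl_cons, inter_comm, ae_le_set]
    refine nonpos_iff_eq_zero.1 ((measure_diff_image_inter_le (ih j) _).trans_eq ?_)
    exact (h.measure_word_image_eq_zero_iff w sdiff_subset (hc.diff hFi)).2 hnull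

theorem exists_list_sum_eq {ι : Type*} {r : ι → ℕ} {n : ℕ}
    (hn : n ∈ AddSubmonoid.closure (range r)) : ∃ l : List ι, (l.map r).sum = n := by
  induction hn using AddSubmonoid.closure_induction with
  | mem x hx =>
    obtain ⟨i, rfl⟩ := hx
    exact ⟨[i], by simp⟩
  | zero => exact ⟨[], rfl⟩
  | add x y _ _ hx hy =>
    obtain ⟨l, rfl⟩ := hx
    obtain ⟨l', rfl⟩ := hy
    exact ⟨l ++ l', by simp⟩

/-- A coprime block yields an element of the partition which returns to itself under the tower map
along two words whose durations differ by one. -/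
theorem IsWGM.exists_consecutive_returns (h : IsWGM m F P) (hR : ∀ x, 0 < R x)
    (hblock : HasCoprimeBlock m F P R) :
    ∃ (b : P) (u v : List P) (a : ℕ), cyl F u ⊆ b ∧ cyl F v ⊆ b ∧
      (b : Set X) ≤ᵐ[m] F^[u.length] '' cyl F u ∧ (b : Set X) ≤ᵐ[m] F^[v.length] '' cyl F v ∧
      (∀ x ∈ cyl F u, (towerMap F R hR)^[a] (toBase hR x) = toBase hR (F^[u.length] x)) ∧
      ∀ x ∈ cyl F v, (towerMap F R hR)^[a + 1] (toBase hR x) = toBase hR (F^[v.length] x) := by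
  obtain ⟨N, ω₀, r, hN, hP, hr, hgcd, hω⟩ := hblock
  set ω : Fin N → P := fun i => ⟨ω₀ i, hP i⟩
  have hω' : ∀ i, (⋃ j, (ω j : Set X)) ≤ᵐ[m] F '' ω i := hω
  have hr' : ∀ i, ∀ x ∈ (ω i : Set X), R x = r i := hr
  have hdvd : Nat.setGcd (range r) ∣ 1 := by
    rw [← hgcd]
    exact Finset.dvd_gcd fun i _ => Nat.setGcd_dvd_of_mem (mem_range_self i)
  -- The numerical semigroup generated by coprime return times contains all large integers, in
  -- particular two consecutive ones.
  obtain ⟨n, hn⟩ := Nat.exists_mem_closure_of_ge (range r)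
  obtain ⟨lu, hlu⟩ := exists_list_sum_eq (hn n le_rfl (hdvd.trans (one_dvd _)))
  obtain ⟨lv, hlv⟩ := exists_list_sum_eq (hn (n + 1) (by omega) (hdvd.trans (one_dvd _)))
  set i : Fin N := ⟨0, by omega⟩
  have hsub : (ω i : Set X) ≤ᵐ[m] (⋃ j, (ω j : Set X) : Set X) :=
    LE.le.eventuallyLE (subset_iUnion (fun j => (ω j : Set X)) i)
  -- The common first letter makes both words start in the same element and adds the same time to
  -- both durations.
  refine ⟨ω i, (i :: lu).map ω, (i :: lv).map ω, r i + n, cyl_cons_subset _ _, cyl_cons_subset _ _,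
    hsub.trans (h.iUnion_le_block_word_image hω' lu i),
    hsub.trans (h.iUnion_le_block_word_image hω' lv i), fun x hx => ?_, fun x hx => ?_⟩
  · rw [List.length_map, ← towerMap_iterate_cyl_map hR hr' (i :: lu) hx, List.map_cons,
      List.sum_cons, hlu]
  · rw [List.length_map, ← towerMap_iterate_cyl_map hR hr' (i :: lv) hx, List.map_cons,
      List.sum_cons, hlv, add_assoc]

/-- Almost no point of the base enters the complement of a tail set from the tail set in one
step. -/
theorem IsWGM.measure_tail_diff_preimage [IsFiniteMeasure m] (h : IsWGM m F P)
    (haper : IsAperiodic m F P) (hRm : Measurable R) (hR : ∀ x, 0 < R x)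
    (hconst : ∀ ω ∈ P, ∀ x ∈ ω, ∀ y ∈ ω, R x = R y) (hblock : HasCoprimeBlock m F P R)
    {A : Set (Tower R)} (hA : IsTail (towerMap F R hR) A) :
    m (toBase hR ⁻¹' (A \ towerMap F R hR ⁻¹' A)) = 0 := by
  set T := towerMap F R hR with hTdef
  have hT : Measurable T := measurable_towerMap h.measurable hRm hR
  set E := toBase hR ⁻¹' (A \ T ⁻¹' A) with hEdef
  have hE : MeasurableSet E :=
    measurable_toBase hR (hA.measurableSet.diff (hT hA.measurableSet))
  by_contra hE0
  obtain ⟨b, u, v, a, hub, hvb, hbu, hbv, hu, hv⟩ := h.exists_consecutive_returns hR hblock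
  obtain ⟨Ku, hKu, hKule⟩ := h.exists_measure_diff_word_image_le hbu
  obtain ⟨Kv, hKv, hKvle⟩ := h.exists_measure_diff_word_image_le hbv
  obtain ⟨ε, hε, hlt⟩ := ENNReal.exists_nnreal_pos_mul_lt (ENNReal.add_ne_top.2 ⟨hKu, hKv⟩)
    (h.measure_ne_zero b)
  obtain ⟨l, hl⟩ := h.exists_word_measure_diff_le haper b hE hE0 (ENNReal.coe_ne_zero.2 hε.ne')
  set G := F^[l.length] '' (cyl F l ∩ E) with hGdef
  have hG : MeasurableSet G :=
    h.measurableSet_word_image l inter_subset_left ((h.measurableSet_cyl l).inter hE)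
  have hbad : m ((b \ F^[u.length] '' (cyl F u ∩ G)) ∪ (b \ F^[v.length] '' (cyl F v ∩ G))) <
      m b := by
    refine lt_of_le_of_lt ?_ hlt
    calc _ ≤ Ku * m (cyl F u \ G) + Kv * m (cyl F v \ G) :=
          (measure_union_le _ _).trans (add_le_add (hKule G hG) (hKvle G hG))
      _ ≤ Ku * ε + Kv * ε := by
          gcongr
          · exact (measure_mono (sdiff_subset_sdiff_left hub)).trans hl
          · exact (measure_mono (sdiff_subset_sdiff_left hvb)).trans hl
      _ = ε * (Ku + Kv) := by ring
  -- The two missed parts do not exhaust b, so some z is reached from E along both return words.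
  obtain ⟨z, hzb, hz⟩ := not_subset.1 fun hsub => hbad.not_ge (measure_mono hsub)
  rw [mem_union, not_or, Set.mem_sdiff, Set.mem_sdiff, not_and_not_right, not_and_not_right] at hz
  obtain ⟨τ, hτ⟩ := exists_towerMap_iterate_cyl hR hconst l
  obtain ⟨B, -, hB⟩ := hA (a + τ)
  obtain ⟨_, ⟨hyu, ⟨x, ⟨hxl, hxE⟩, rfl⟩⟩, hxz⟩ := hz.1 hzb
  obtain ⟨_, ⟨hyv, ⟨x', ⟨hxl', hxE'⟩, rfl⟩⟩, hxz'⟩ := hz.2 hzb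
  have h1 : toBase hR z ∈ B := by
    have := hxE.1
    rw [← hB, mem_preimage, Function.iterate_add_apply, hτ x hxl, hu _ hyu, hxz] at this
    exact this
  refine hxE'.2 ?_
  rw [mem_preimage, ← hB, mem_preimage, ← Function.iterate_succ_apply,
    show (a + τ).succ = a + 1 + τ by omega, Function.iterate_add_apply, hτ x' hxl', hv _ hyv, hxz']
  exact h1

/-- Almost every orbit starting in the base never leaves a tail set or never enters it. -/
theorem IsWGM.ae_tail_iff [IsFiniteMeasure m] (h : IsWGM m F P)
    (haper : IsAperiodic m F P) (hRm : Measurable R) (hR : ∀ x, 0 < R x)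
    (hconst : ∀ ω ∈ P, ∀ x ∈ ω, ∀ y ∈ ω, R x = R y) (hblock : HasCoprimeBlock m F P R)
    {A : Set (Tower R)} (hA : IsTail (towerMap F R hR) A) :
    ∀ᵐ x ∂m, ∀ j, (towerMap F R hR)^[j] (toBase hR x) ∈ A ↔ toBase hR x ∈ A := by
  have hT : Measurable (towerMap F R hR) := measurable_towerMap h.measurable hRm hR
  have hstep : ∀ {B : Set (Tower R)}, IsTail (towerMap F R hR) B → ∀ᵐ x ∂m, ∀ j,
      (towerMap F R hR)^[j] (toBase hR x) ∈ B → (towerMap F R hR)^[j + 1] (toBase hR x) ∈ B := by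
    intro B hB
    rw [ae_all_iff]
    intro j
    filter_upwards [measure_eq_zero_iff_ae_notMem.1 (h.measure_tail_diff_preimage haper hRm hR
      hconst hblock (hB.preimage hT j))] with x hx hxB
    by_contra hcon
    exact hx ⟨hxB, hcon⟩
  filter_upwards [hstep hA, hstep hA.compl] with x hx hx' j
  induction j with
  | zero => rfl
  | succ j ih =>
    rw [← ih]
    exact ⟨fun hj => by_contra fun hcon => hx' j hcon hj, hx j⟩

/-- A tail set of positive measure on the base fills some fixed element of the partition. -/
theorem IsWGM.measure_diff_tail [IsFiniteMeasure m] (h : IsWGM m F P)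
    (haper : IsAperiodic m F P) (hRm : Measurable R) (hR : ∀ x, 0 < R x)
    (hconst : ∀ ω ∈ P, ∀ x ∈ ω, ∀ y ∈ ω, R x = R y) (hblock : HasCoprimeBlock m F P R) (b : P)
    {A : Set (Tower R)} (hA : IsTail (towerMap F R hR) A) (hA0 : m (toBase hR ⁻¹' A) ≠ 0) :
    m (b \ toBase hR ⁻¹' A) = 0 := by
  set T := towerMap F R hR
  have hT : Measurable T := measurable_towerMap h.measurable hRm hR
  -- The entire orbit must stay in A, because the duration of the spreading word is known only after
  -- E has been chosen.
  set E : Set X := ⋂ j, toBase hR ⁻¹' (T^[j] ⁻¹' A)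
  have hE : MeasurableSet E := .iInter fun j =>
    measurable_toBase hR ((hT.iterate j) hA.measurableSet)
  have hE0 : m E ≠ 0 := by
    have : E =ᵐ[m] (toBase hR ⁻¹' A : Set X) := by
      filter_upwards [h.ae_tail_iff haper hRm hR hconst hblock hA] with x hx
      refine propext ⟨fun hxE => ?_, fun hxA => mem_iInter.2 fun j => (hx j).2 hxA⟩
      exact mem_iInter.1 hxE 0
    rwa [measure_congr this]
  by_contra hne
  obtain ⟨ε, hε0, hε⟩ := exists_between (pos_iff_ne_zero.2 hne)
  obtain ⟨l, hl⟩ := h.exists_word_measure_diff_le haper b hE hE0 hε0.ne'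
  refine ((measure_mono ?_).trans hl).not_gt hε
  refine sdiff_subset_sdiff_right ?_
  rintro _ ⟨x, ⟨hxl, hxE⟩, rfl⟩
  obtain ⟨τ, hτ⟩ := exists_towerMap_iterate_cyl hR hconst l
  have := mem_iInter.1 hxE τ
  rwa [mem_preimage, mem_preimage, hτ x hxl] at this

/-- Every point of the tower lies on the orbit of the base point below it, so nullity at the base
propagates to all levels. -/
theorem IsWGM.towerMeasure_tail_eq_zero [IsFiniteMeasure m] (h : IsWGM m F P)
    (haper : IsAperiodic m F P) (hRm : Measurable R) (hR : ∀ x, 0 < R x)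
    (hconst : ∀ ω ∈ P, ∀ x ∈ ω, ∀ y ∈ ω, R x = R y) (hblock : HasCoprimeBlock m F P R)
    {A : Set (Tower R)} (hA : IsTail (towerMap F R hR) A) (hA0 : m (toBase hR ⁻¹' A) = 0) :
    towerMeasure m R A = 0 := by
  rw [towerMeasure_apply hRm hA.measurableSet, ENNReal.tsum_eq_zero]
  intro ℓ
  refine measure_mono_null_ae ?_ hA0
  filter_upwards [h.ae_tail_iff haper hRm hR hconst hblock hA] with x hx ⟨hℓ, hxA⟩
  rwa [← towerMap_iterate_toBase (F := F) hR x hℓ, hx ℓ] at hxA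

/-- Tail sets of the tower are null or conull. -/
theorem IsWGM.tail_trivial [IsFiniteMeasure m] (h : IsWGM m F P)
    (haper : IsAperiodic m F P) (hRm : Measurable R) (hR : ∀ x, 0 < R x)
    (hconst : ∀ ω ∈ P, ∀ x ∈ ω, ∀ y ∈ ω, R x = R y) (hblock : HasCoprimeBlock m F P R)
    (A : Set (Tower R)) (hA : IsTail (towerMap F R hR) A) :
    towerMeasure m R A = 0 ∨ towerMeasure m R Aᶜ = 0 := by
  obtain ⟨b, -⟩ := h.exists_consecutive_returns hR hblock
  by_cases h0 : m (toBase hR ⁻¹' A) = 0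
  · exact .inl (h.towerMeasure_tail_eq_zero haper hRm hR hconst hblock hA h0)
  by_cases h1 : m (toBase hR ⁻¹' Aᶜ) = 0
  · exact .inr (h.towerMeasure_tail_eq_zero haper hRm hR hconst hblock hA.compl h1)
  refine absurd ?_ (h.measure_ne_zero b)
  refine measure_mono_null ?_ (measure_union_null
    (h.measure_diff_tail haper hRm hR hconst hblock b hA h0)
    (h.measure_diff_tail haper hRm hR hconst hblock b hA.compl h1))
  intro x hx
  by_cases hxA : toBase hR x ∈ A
  · exact .inr ⟨hx, fun hcon => hcon hxA⟩
  · exact .inl ⟨hx, hxA⟩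

end TailTriviality

end WeakGibbsMarkov

theorem mainTheorem5 {M : Type*} [MeasurableSpace M] (m : Measure M)
    (f : M → M) (hf : Measurable f)
    (Δ₀ : Set M) (hΔ₀ : MeasurableSet Δ₀) (hpos : 0 < m Δ₀) (hfin : m Δ₀ < ∞)
    (F : Δ₀ → Δ₀) (P : Set (Set Δ₀)) (R : Δ₀ → ℕ) (hR : ∀ x, 0 < R x)
    (hind : WeakGibbsMarkov.IsInducedMap m f Δ₀ F P R)
    (hwgm : WeakGibbsMarkov.IsWGM (m.comap ((↑) : Δ₀ → M)) F P)
    (haper : WeakGibbsMarkov.IsAperiodic (m.comap ((↑) : Δ₀ → M)) F P)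
    (hblock : WeakGibbsMarkov.HasCoprimeBlock (m.comap ((↑) : Δ₀ → M)) F P R)
    (hint : Integrable (fun x : Δ₀ => (R x : ℝ)) (m.comap ((↑) : Δ₀ → M))) :
    (∃! ν : Measure (WeakGibbsMarkov.Tower R),
      WeakGibbsMarkov.IsACIP (WeakGibbsMarkov.towerMap F R hR)
        (WeakGibbsMarkov.towerMeasure (m.comap ((↑) : Δ₀ → M)) R) ν) ∧
    ∀ ν : Measure (WeakGibbsMarkov.Tower R),
      WeakGibbsMarkov.IsACIP (WeakGibbsMarkov.towerMap F R hR)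
        (WeakGibbsMarkov.towerMeasure (m.comap ((↑) : Δ₀ → M)) R) ν →
      WeakGibbsMarkov.IsExact (WeakGibbsMarkov.towerMap F R hR) ν ∧
      WeakGibbsMarkov.IsMixing (WeakGibbsMarkov.towerMap F R hR) ν := by
  have hfinm : IsFiniteMeasure (m.comap ((↑) : Δ₀ → M)) := by
    refine ⟨?_⟩
    rw [(MeasurableEmbedding.subtype_coe hΔ₀).comap_apply]
    simpa using hfin
  have hm0 : m.comap ((↑) : Δ₀ → M) univ ≠ 0 := by
    rw [(MeasurableEmbedding.subtype_coe hΔ₀).comap_apply]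
    simpa using hpos.ne'
  have htail := hwgm.tail_trivial haper hind.measurable hR hind.const hblock
  obtain ⟨K, hK, hKle⟩ := hwgm.exists_measure_preimage_le
  obtain ⟨μ, hμ, hμle, hμuniv⟩ :=
    WeakGibbsMarkov.exists_invariant_le hwgm.measurable hK hKle
  obtain ⟨ν, hν⟩ := WeakGibbsMarkov.exists_isACIP_tower hμ hK hμle (by rwa [hμuniv])
    hind.measurable hR hint
  refine ⟨⟨ν, hν, fun ν' hν' => hν'.unique htail hν⟩, fun ν' hν' => ?_⟩
  have := hν'.prob
  have hexact := hν'.isExact htail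
  exact ⟨hexact, hexact.isMixing hν'.invariant⟩
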